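/- Let $L$ be a countable one-sorted continuous signature whose metric and predicates take values in $[0,1]$, and let $C$ be a countably infinite set of new constant symbols; $L$-structures are complete, formulas are finitary and built with arbitrary continuous connectives $[0,1]^k\to[0,1]$ and $\sup,\inf$. An $L$-theory $T$ is a set of closed conditions $\sigma=0$ with $\sigma$ an $L$-sentence. For an $L$-structure $D$, let $\operatorname{Th}_\forall(D)$ be the set of conditions $\sigma=0$ true in $D$ with $\sigma=\sup_{x_1}\cdots\sup_{x_m}\varphi(x)$, $\varphi$ a quantifier-free $L$-formula. \emph{The game.} Fix an $L$-theory $T$. A \emph{condition} is a finite set $p$ of expressions $\varphi<r$, with $r\in\mathbb R$ and $\varphi$ a quantifier-free $L(C)$-sentence built from atomic ones using only the connectives $t\mapsto t/2$, $t\mapsto 1-t$ and $(s,t)\mapsto\min(s+t,1)$, such that $T\cup p$ is satisfiable. Two players $\forall$ and $\exists$ alternately play conditions $p_0\subseteq p_1\subseteq p_2\subseteq\cdots$, with $\forall$ playing $p_0$; put $\bar p=\bigcup_i p_i$. The play is \emph{definitive} if for every atomic $L(C)$-sentence $\varphi$ there is a unique $r\in[0,1]$ with $T\cup\bar p\models\varphi=r$;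 these values then define a prestructure on the set of closed $L(C)$-terms, whose completion $A^+(\bar p)$ is the \emph{compiled structure}. For a property $P$ of $L(C)$-structures, $\exists$ wins $G(P)$ if the play is definitive and $A^+(\bar p)$ has $P$; $P$ is \emph{enforceable} if $\exists$ has a winning strategy in $G(P)$. A condition $p$ \emph{forces} $P$ if every position $(p_0,\dots,p_k)$ of $G(P)$ with $p\subseteq p_k$ is winning for $\exists$. \emph{Finite-generic structures.} An $L$-structure $B$ is \emph{finite-generic with respect to $T$} if it has an expansion $B^+$ to an $L(C)$-structure in which the interpretations of the symbols from $C$ are dense and such that, for every $L(C)$-sentence $\varphi$ and every real $r>0$, one has $\varphi^{B^+}<r$ if and only if some condition $p$, all of whose expressions are true in $B^+$, forces the property $\varphi<r$. \emph{Prime and enforceable models.} $D$ is \emph{the prime model of its theory} if $D$ embeds elementarily into every $L$-structure that is elementarily equivalent to $D$. $D$ is \emph{the enforceable model of $T$} if $D\models T$, the property ``the $L$-reduct of the compiled structure is isomorphic to $D$'' is enforceable, and every $L$-structure $E$ for which being isomorphic to $E$ is likewise enforceable is isomorphic to $D$. \textbf{Theorem.} Suppose that the $L$-structure $D$ is finite-generic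 with respect to $\operatorname{Th}_\forall(D)$ and is the prime model of its theory. Then $D$ is the enforceable model of $\operatorname{Th}_\forall(D)$. -/

import Mathlib

universe u

noncomputable section

namespace ContLogic

open UniformSpace

/-! ### Signatures and (pre)structures of one-sorted bounded continuous logic -/

/-- A one-sorted continuous signature: function symbols (constants are the nullary ones) and
predicate symbols, each with a modulus of uniform continuity. The metric is a logical symbol of
diameter at most `1`; all predicates take values in `[0,1]`. -/
structure Signature where
  Func : ℕ → Type u
  Pred : ℕ → Type u
  funcMod : ∀ {n : ℕ}, Func n → ℝ → ℝ
  predMod : ∀ {n : ℕ}, Pred n → ℝ → ℝ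
  funcMod_pos : ∀ {n : ℕ} (f : Func n) (ε : ℝ), 0 < ε → 0 < funcMod f ε
  predMod_pos : ∀ {n : ℕ} (P : Pred n) (ε : ℝ), 0 < ε → 0 < predMod P ε

/-- Interpretations of the symbols of `L` on a pseudometric space of diameter at most `1`.
The distance on `Fin n → M` is the maximum distance. -/
class Signature.Prestructure (L : Signature.{u}) (M : Type u) [PseudoMetricSpace M] where
  dist_le_one : ∀ x y : M, dist x y ≤ 1
  func : ∀ {n : ℕ}, L.Func n → (Fin n → M) → M
  pred : ∀ {n : ℕ}, L.Pred n → (Fin n → M) → unitInterval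
  func_uc : ∀ {n : ℕ} (f : L.Func n) (ε : ℝ), 0 < ε → ∀ x y : Fin n → M,
    dist x y < L.funcMod f ε → dist (func f x) (func f y) ≤ ε
  pred_uc : ∀ {n : ℕ} (P : L.Pred n) (ε : ℝ), 0 < ε → ∀ x y : Fin n → M,
    dist x y < L.predMod P ε → dist (pred P x) (pred P y) ≤ ε

/-- An `L`-structure: a nonempty prestructure on a complete metric space. -/
structure Signature.Structure (L : Signature.{u}) where
  carrier : Type u
  [metric : MetricSpace carrier]
  [complete : CompleteSpace carrier]
  [nonempty : Nonempty carrier]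
  [str : L.Prestructure carrier]

instance (L : Signature.{u}) : CoeSort L.Structure (Type u) := ⟨Signature.Structure.carrier⟩

attribute [instance] Signature.Structure.metric Signature.Structure.complete
  Signature.Structure.nonempty Signature.Structure.str

variable {L : Signature.{u}}

/-! ### Terms and formulas -/

inductive Signature.Term (L : Signature.{u}) (α : Type u) : Type u
  | var (a : α) : L.Term α
  | func {n : ℕ} (f : L.Func n) (ts : Fin n → L.Term α) : L.Term α

/-- The value of a term under an assignment. -/
def Signature.Term.realize {α : Type u} {M : Type u} [PseudoMetricSpace M] [L.Prestructure M]
    (v : α → M) : L.Term α → M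
  | .var a => v a
  | .func f ts => Signature.Prestructure.func f (fun i => (ts i).realize v)

/-- A `k`-ary connective: any continuous function `[0,1]^k → [0,1]`. -/
abbrev Connective (k : ℕ) : Type := C(Fin k → unitInterval, unitInterval)

/-- (Finitary) formulas with parameters or constants from `α` and free variables `x_0, …, x_{n-1}`.
`sup φ` and `inf φ` quantify the last variable `x_n` of `φ`. -/
inductive Signature.Formula (L : Signature.{u}) (α : Type u) : ℕ → Type u
  | dist {n : ℕ} (s t : L.Term (α ⊕ Fin n)) : L.Formula α n
  | pred {n k : ℕ} (P : L.Pred k) (ts : Fin k → L.Term (α ⊕ Fin n)) : L.Formula α n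
  | conn {n k : ℕ} (g : Connective k) (φs : Fin k → L.Formula α n) : L.Formula α n
  | sup {n : ℕ} (φ : L.Formula α (n + 1)) : L.Formula α n
  | inf {n : ℕ} (φ : L.Formula α (n + 1)) : L.Formula α n

/-- The value of a formula in a structure. -/
def Signature.Formula.realize {α : Type u} {M : Type u} [PseudoMetricSpace M] [L.Prestructure M]
    (v : α → M) : ∀ {n : ℕ}, L.Formula α n → (Fin n → M) → unitInterval
  | _, .dist s t, x =>
      ⟨Dist.dist (s.realize (Sum.elim v x)) (t.realize (Sum.elim v x)),
        dist_nonneg, Signature.Prestructure.dist_le_one L _ _⟩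
  | _, .pred P ts, x => Signature.Prestructure.pred P (fun i => (ts i).realize (Sum.elim v x))
  | _, .conn g φs, x => g (fun i => (φs i).realize v x)
  | _, .sup φ, x => ⨆ a : M, φ.realize v (Fin.snoc x a)
  | _, .inf φ, x => ⨅ a : M, φ.realize v (Fin.snoc x a)

/-- `L`-formulas in the variables `x_0, …, x_{n-1}`. -/
abbrev Signature.LFormula (L : Signature.{u}) (n : ℕ) : Type u := L.Formula PEmpty.{u + 1} n

/-- `L`-sentences. -/
abbrev Signature.Sentence (L : Signature.{u}) : Type u := L.LFormula 0

/-- `L(C)`-sentences. The new constant symbols `c ∈ C` occur as terms `Term.var (Sum.inl c)`. -/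
abbrev Signature.CSentence (L : Signature.{u}) (C : Type u) : Type u := L.Formula C 0

/-- Closed `L(C)`-terms. -/
abbrev Signature.CTerm (L : Signature.{u}) (C : Type u) : Type u := L.Term (C ⊕ Fin 0)

/-- An `L(C)`-structure: an `L`-structure (its `L`-reduct) with an interpretation of the
constant symbols from `C`. -/
structure Signature.CStructure (L : Signature.{u}) (C : Type u) where
  reduct : L.Structure
  const : C → reduct

/-- The value `φ(a)` in `M` of an `L`-formula. -/
def Signature.LFormula.val (M : L.Structure) {n : ℕ} (φ : L.LFormula n) (a : Fin n → M) :
    unitInterval :=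
  Signature.Formula.realize (fun e : PEmpty.{u + 1} => e.elim) φ a

/-- The value of an `L`-sentence in `M`. -/
def Signature.Sentence.val (M : L.Structure) (σ : L.Sentence) : unitInterval :=
  Signature.LFormula.val M σ Fin.elim0

/-- The value of an `L(C)`-sentence in an `L(C)`-structure. -/
def Signature.CSentence.val {C : Type u} (A : L.CStructure C) (φ : L.CSentence C) : unitInterval :=
  Signature.Formula.realize A.const φ Fin.elim0

/-! ### Classes of formulas -/

inductive Signature.Formula.IsAtomic {α : Type u} : ∀ {n : ℕ}, L.Formula α n → Prop
  | dist {n : ℕ} (s t : L.Term (α ⊕ Fin n)) : IsAtomic (.dist s t)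
  | pred {n k : ℕ} (P : L.Pred k) (ts : Fin k → L.Term (α ⊕ Fin n)) : IsAtomic (.pred P ts)

/-- Quantifier-free formulas. -/
inductive Signature.Formula.IsQF {α : Type u} : ∀ {n : ℕ}, L.Formula α n → Prop
  | atomic {n : ℕ} (φ : L.Formula α n) : φ.IsAtomic → IsQF φ
  | conn {n k : ℕ} (g : Connective k) (φs : Fin k → L.Formula α n) :
      (∀ i, IsQF (φs i)) → IsQF (.conn g φs)

/-- Universal formulas: `sup_{y_1} ⋯ sup_{y_m} φ` with `φ` quantifier-free. -/
inductive Signature.Formula.IsUniversal {α : Type u} : ∀ {n : ℕ}, L.Formula α n → Prop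
  | qf {n : ℕ} (φ : L.Formula α n) : φ.IsQF → IsUniversal φ
  | sup {n : ℕ} (φ : L.Formula α (n + 1)) : IsUniversal φ → IsUniversal (.sup φ)

/-- The connective `r ↦ r / 2`. -/
def halfConn : Connective 1 where
  toFun x := ⟨(x 0 : ℝ) / 2, by have := (x 0).2.1; linarith, by have := (x 0).2.2; linarith⟩
  continuous_toFun := by fun_prop

/-- The connective `r ↦ 1 - r`. -/
def negConn : Connective 1 where
  toFun x := ⟨1 - (x 0 : ℝ), by have := (x 0).2.2; linarith, by have := (x 0).2.1; linarith⟩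
  continuous_toFun := by fun_prop

/-- Truncated addition `(r, s) ↦ min (r + s) 1`. -/
def addConn : Connective 2 where
  toFun x := ⟨min ((x 0 : ℝ) + x 1) 1,
    le_min (add_nonneg (x 0).2.1 (x 1).2.1) zero_le_one, min_le_right _ _⟩
  continuous_toFun := by fun_prop

/-- Restricted quantifier-free formulas: built from atomic formulas with the connectives
`r / 2`, `1 - r` and truncated addition only. -/
inductive Signature.Formula.IsRestrictedQF {α : Type u} : ∀ {n : ℕ}, L.Formula α n → Prop
  | atomic {n : ℕ} (φ : L.Formula α n) : φ.IsAtomic → IsRestrictedQF φ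
  | half {n : ℕ} (φ : L.Formula α n) : IsRestrictedQF φ → IsRestrictedQF (.conn halfConn ![φ])
  | neg {n : ℕ} (φ : L.Formula α n) : IsRestrictedQF φ → IsRestrictedQF (.conn negConn ![φ])
  | add {n : ℕ} (φ ψ : L.Formula α n) : IsRestrictedQF φ → IsRestrictedQF ψ →
      IsRestrictedQF (.conn addConn ![φ, ψ])

/-! ### Theories, elementary equivalence, prime models, isomorphism -/

/-- A theory is a set of sentences `σ`, standing for the closed conditions `σ = 0`. -/
abbrev Signature.Theory (L : Signature.{u}) : Type u := Set L.Sentence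

def Signature.Structure.Models (M : L.Structure) (T : L.Theory) : Prop :=
  ∀ σ ∈ T, Signature.Sentence.val M σ = 0

/-- `Th_∀(D)`: the conditions `σ = 0` true in `D` with `σ` a universal sentence. -/
def universalTheory (D : L.Structure) : L.Theory :=
  {σ | Signature.Formula.IsUniversal σ ∧ Signature.Sentence.val D σ = 0}

def ElementarilyEquivalent (A B : L.Structure) : Prop :=
  ∀ σ : L.Sentence, Signature.Sentence.val A σ = Signature.Sentence.val B σ

def IsElementaryEmbedding (A B : L.Structure) (θ : A → B) : Prop :=
  ∀ (n : ℕ) (φ : L.LFormula n) (a : Fin n → A),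
    Signature.LFormula.val B φ (θ ∘ a) = Signature.LFormula.val A φ a

/-- `D` is the prime model of its theory. -/
def IsPrimeModel (D : L.Structure) : Prop :=
  ∀ E : L.Structure, ElementarilyEquivalent E D → ∃ θ : D → E, IsElementaryEmbedding D E θ

def Isomorphic (A B : L.Structure) : Prop :=
  ∃ e : A ≃ B, Isometry e ∧
    (∀ (n : ℕ) (f : L.Func n) (x : Fin n → A),
      e (Signature.Prestructure.func f x) = Signature.Prestructure.func f (e ∘ x)) ∧
    ∀ (n : ℕ) (P : L.Pred n) (x : Fin n → A),
      Signature.Prestructure.pred P (e ∘ x) = Signature.Prestructure.pred P x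

/-! ### Conditions -/

variable {C : Type u}

/-- The pair `(φ, r)` stands for the expression `φ < r`. -/
abbrev Signature.Expr (L : Signature.{u}) (C : Type u) : Type u := L.CSentence C × ℝ

/-- `A⁺` is a model of `T ∪ p`. -/
def Signature.CStructure.Satisfies (A : L.CStructure C) (T : L.Theory) (p : Set (L.Expr C)) :
    Prop :=
  A.reduct.Models T ∧ ∀ e ∈ p, (Signature.CSentence.val A e.1 : ℝ) < e.2

/-- The conditions with respect to `T`, ordered by inclusion. -/
def Condition (T : L.Theory) (C : Type u) : Type u :=
  {p : Set (L.Expr C) // p.Finite ∧ (∀ e ∈ p, Signature.Formula.IsRestrictedQF e.1) ∧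
    ∃ A : L.CStructure C, A.Satisfies T p}

instance (T : L.Theory) : PartialOrder (Condition T C) :=
  inferInstanceAs (PartialOrder (Subtype _))

/-! ### The compiled structure -/

/-- `T ∪ p ⊨ φ = r`. -/
def Entails (T : L.Theory) (p : Set (L.Expr C)) (φ : L.CSentence C) (r : unitInterval) : Prop :=
  ∀ A : L.CStructure C, A.Satisfies T p → Signature.CSentence.val A φ = r

/-- `T ∪ p` decides the value of each atomic `L(C)`-sentence. -/
def Definitive (T : L.Theory) (p : Set (L.Expr C)) : Prop :=
  ∀ φ : L.CSentence C, φ.IsAtomic → ∃! r : unitInterval, Entails T p φ r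

section compiled

variable {T : L.Theory} {p : Set (L.Expr C)}

/-- The value of an atomic sentence that is decided by a definitive `p`. -/
def Definitive.value (h : Definitive T p) (φ : L.CSentence C) (hφ : φ.IsAtomic) : unitInterval :=
  (h φ hφ).choose

lemma Definitive.value_eq (h : Definitive T p) {φ : L.CSentence C} (hφ : φ.IsAtomic)
    {A : L.CStructure C} (hA : A.Satisfies T p) :
    h.value φ hφ = Signature.CSentence.val A φ :=
  ((h φ hφ).choose_spec.1 A hA).symm

lemma Definitive.exists_model [Nonempty C] (h : Definitive T p) :
    ∃ A : L.CStructure C, A.Satisfies T p := by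
  by_contra hA
  push Not at hA
  obtain ⟨c⟩ := ‹Nonempty C›
  obtain ⟨r, -, hr⟩ := h (.dist (.var (.inl c)) (.var (.inl c))) (.dist _ _)
  have h0 := hr 0 fun A hA' => (hA A hA').elim
  have h1 := hr 1 fun A hA' => (hA A hA').elim
  exact zero_ne_one (h0.trans h1.symm)

/-- The pseudometric of the prestructure `A₀⁺` on the set of closed `L(C)`-terms. -/
@[reducible]
def Definitive.pseudoMetric [Nonempty C] (h : Definitive T p) :
    PseudoMetricSpace (L.CTerm C) where
  dist s t := h.value (.dist s t) (.dist s t)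
  dist_self s := by
    obtain ⟨A, hA⟩ := h.exists_model
    simp [h.value_eq _ hA, Signature.CSentence.val, Signature.Formula.realize]
  dist_comm s t := by
    obtain ⟨A, hA⟩ := h.exists_model
    simp [h.value_eq _ hA, Signature.CSentence.val, Signature.Formula.realize, dist_comm]
  dist_triangle s t w := by
    obtain ⟨A, hA⟩ := h.exists_model
    simpa [h.value_eq _ hA, Signature.CSentence.val, Signature.Formula.realize] using
      dist_triangle _ _ _

lemma Definitive.dist_eq [Nonempty C] (h : Definitive T p)
    {A : L.CStructure C} (hA : A.Satisfies T p) (s t : L.CTerm C) :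
    h.pseudoMetric.dist s t = dist (s.realize (Sum.elim A.const Fin.elim0))
      (t.realize (Sum.elim A.const Fin.elim0)) := by
  change (h.value (.dist s t) (.dist s t) : ℝ) = _
  rw [h.value_eq _ hA]
  rfl

lemma Definitive.dist_pi_eq [Nonempty C] (h : Definitive T p)
    {A : L.CStructure C} (hA : A.Satisfies T p) {n : ℕ} (x y : Fin n → L.CTerm C) :
    (letI := h.pseudoMetric; dist x y) =
      dist (fun i => (x i).realize (Sum.elim A.const Fin.elim0))
        (fun i => (y i).realize (Sum.elim A.const Fin.elim0)) := by
  let := h.pseudoMetric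
  have key : ∀ i, nndist (x i) (y i) =
      nndist ((x i).realize (Sum.elim A.const Fin.elim0))
        ((y i).realize (Sum.elim A.const Fin.elim0)) := fun i =>
    NNReal.eq (h.dist_eq hA (x i) (y i))
  simp only [dist_pi_def, key]

/-- The prestructure `A₀⁺`: the term algebra over `C`, with the predicates taking the values
decided by `T ∪ p`. -/
@[reducible]
def Definitive.prestructure [Nonempty C] (h : Definitive T p) :
    letI := h.pseudoMetric
    L.Prestructure (L.CTerm C) :=
  letI := h.pseudoMetric
  { dist_le_one := fun s t => (h.value (.dist s t) (.dist s t)).2.2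
    func := fun f ts => .func f ts
    pred := fun P ts => h.value (.pred P ts) (.pred P ts)
    func_uc := by
      intro n f ε hε x y hxy
      obtain ⟨A, hA⟩ := h.exists_model
      rw [h.dist_pi_eq hA] at hxy
      exact (h.dist_eq hA _ _).trans_le (Signature.Prestructure.func_uc f ε hε _ _ hxy)
    pred_uc := by
      intro n P ε hε x y hxy
      obtain ⟨A, hA⟩ := h.exists_model
      rw [h.dist_pi_eq hA] at hxy
      rw [h.value_eq _ hA, h.value_eq _ hA]
      exact Signature.Prestructure.pred_uc P ε hε _ _ hxy }

end compiled

/-! ### Completion of a prestructure -/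

section completion

variable {X : Type u} [PseudoMetricSpace X]

/-- The canonical map `Xⁿ → (completion of X)ⁿ`. -/
def piCoe (X : Type u) [PseudoMetricSpace X] (n : ℕ) (x : Fin n → X) : Fin n → Completion X :=
  fun i => (x i : Completion X)

lemma piCoe_isometry (n : ℕ) : Isometry (piCoe X n) := by
  refine Isometry.of_dist_eq fun x y => ?_
  have key : ∀ i, nndist (piCoe X n x i) (piCoe X n y i) = nndist (x i) (y i) := fun i =>
    NNReal.eq (Completion.dist_eq (x i) (y i))
  simp only [dist_pi_def, key]

lemma piCoe_denseRange (n : ℕ) : DenseRange (piCoe X n) :=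
  DenseRange.piMap fun _ => Completion.denseRange_coe

lemma piCoe_isDenseInducing (n : ℕ) : IsDenseInducing (piCoe X n) :=
  ⟨(piCoe_isometry n).isUniformInducing.isInducing, piCoe_denseRange n⟩

/-- Extension by continuity of a map on `Xⁿ` to the completion. -/
def extendPi {Y : Type*} [TopologicalSpace Y] {n : ℕ} (g : (Fin n → X) → Y) :
    (Fin n → Completion X) → Y :=
  (piCoe_isDenseInducing n).extend g

lemma extendPi_uc {Y : Type*} [MetricSpace Y] [CompleteSpace Y] {n : ℕ}
    (g : (Fin n → X) → Y) (Δ : ℝ → ℝ) (hΔ : ∀ ε, 0 < ε → 0 < Δ ε)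
    (hg : ∀ ε, 0 < ε → ∀ x y, dist x y < Δ ε → dist (g x) (g y) ≤ ε)
    (ε : ℝ) (hε : 0 < ε) (x y : Fin n → Completion X) (hxy : dist x y < Δ ε) :
    dist (extendPi g x) (extendPi g y) ≤ ε := by
  have huc : UniformContinuous g := Metric.uniformContinuous_iff.2 fun η hη =>
    ⟨Δ (η / 2), hΔ _ (half_pos hη), fun {a b} hab =>
      (hg _ (half_pos hη) a b hab).trans_lt (half_lt_self hη)⟩
  have hcont : Continuous (extendPi g) :=
    (uniformContinuous_uniformly_extend (piCoe_isometry n).isUniformInducing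
      (piCoe_denseRange n) huc).continuous
  have hval : ∀ a, extendPi g (piCoe X n a) = g a := fun a =>
    (piCoe_isDenseInducing n).extend_eq huc.continuous a
  by_contra hcon
  push Not at hcon
  let U : Set ((Fin n → Completion X) × (Fin n → Completion X)) :=
    {z | dist z.1 z.2 < Δ ε} ∩ {z | ε < dist (extendPi g z.1) (extendPi g z.2)}
  have hU : IsOpen U :=
    (isOpen_lt (by fun_prop) continuous_const).inter
      (isOpen_lt continuous_const
        ((hcont.comp continuous_fst).dist (hcont.comp continuous_snd)))
  obtain ⟨⟨a, b⟩, hab⟩ := ((piCoe_denseRange (X := X) n).prodMap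
    (piCoe_denseRange (X := X) n)).exists_mem_open hU ⟨(x, y), hxy, hcon⟩
  have h1 : dist a b < Δ ε := by
    have : dist (piCoe X n a) (piCoe X n b) < Δ ε := hab.1
    rwa [(piCoe_isometry n).dist_eq] at this
  have h2 : ε < dist (g a) (g b) := by
    have : ε < dist (extendPi g (piCoe X n a)) (extendPi g (piCoe X n b)) := hab.2
    rwa [hval, hval] at this
  exact absurd (hg ε hε a b h1) (not_le.2 h2)

instance completionPrestructure [L.Prestructure X] : L.Prestructure (Completion X) where
  dist_le_one x y := by
    refine Completion.induction_on₂ x y (isClosed_le (by fun_prop) continuous_const) ?_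
    intro a b
    rw [Completion.dist_eq]
    exact Signature.Prestructure.dist_le_one L a b
  func f := extendPi fun x : Fin _ → X =>
    ((Signature.Prestructure.func f x : X) : Completion X)
  pred P := extendPi fun x : Fin _ → X => Signature.Prestructure.pred P x
  func_uc f ε hε x y hxy := by
    refine extendPi_uc _ (L.funcMod f) (L.funcMod_pos f) (fun η hη a b hab => ?_) ε hε x y hxy
    rw [Completion.dist_eq]
    exact Signature.Prestructure.func_uc f η hη a b hab
  pred_uc P ε hε x y hxy :=
    extendPi_uc _ (L.predMod P) (L.predMod_pos P)
      (fun η hη a b hab => Signature.Prestructure.pred_uc P η hη a b hab) ε hε x y hxy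

/-- The completion of a nonempty prestructure. -/
def completionStructure (L : Signature.{u}) (X : Type u) [PseudoMetricSpace X] [Nonempty X]
    [L.Prestructure X] : L.Structure where
  carrier := Completion X
  nonempty := ⟨((Classical.arbitrary X : X) : Completion X)⟩

end completion

/-- The compiled structure `A⁺(p)`: the completion of `A₀⁺(p)`. -/
def Definitive.compiled [Nonempty C] {T : L.Theory} {p : Set (L.Expr C)} (h : Definitive T p) :
    L.CStructure C :=
  letI := h.pseudoMetric
  letI := h.prestructure
  haveI : Nonempty (L.CTerm C) := ‹Nonempty C›.map fun c => .var (.inl c)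
  { reduct := completionStructure L (L.CTerm C)
    const := fun c => ((Signature.Term.var (Sum.inl c) : L.CTerm C) : Completion (L.CTerm C)) }

/-! ### The game and forcing -/

/-- A strategy for player `∃`: a legal answer to each position `(p_0, …, p_k)`. -/
structure Strategy (T : L.Theory) (C : Type u) where
  move : ∀ k : ℕ, (Fin (k + 1) → Condition T C) → Condition T C
  legal : ∀ (k : ℕ) (pos : Fin (k + 1) → Condition T C), pos (Fin.last k) ≤ move k pos

/-- The set of expressions `⋃ p_i` of a play. -/
def playUnion {T : L.Theory} (p : ℕ → Condition T C) : Set (L.Expr C) := ⋃ i, (p i).1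

/-- `∃` wins the play `p` of `G(P)`: it is definitive and its compiled structure has `P`. -/
def Wins [Nonempty C] (T : L.Theory) (P : L.CStructure C → Prop) (p : ℕ → Condition T C) : Prop :=
  ∃ h : Definitive T (playUnion p), P h.compiled

/-- `P` is enforceable: `∃` has a winning strategy in `G(P)`. Player `∀` chooses `p_0, p_2, …` and
player `∃` chooses `p_1, p_3, …`. -/
def Enforceable [Nonempty C] (T : L.Theory) (P : L.CStructure C → Prop) : Prop :=
  ∃ s : Strategy T C, ∀ p : ℕ → Condition T C, Monotone p →
    (∀ j, Even j → p (j + 1) = s.move j (fun i => p i)) → Wins T P p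

/-- The position `(p_0, …, p_k)` of `G(P)` is winning for `∃`. -/
def WinningPosition [Nonempty C] (T : L.Theory) (P : L.CStructure C → Prop) (k : ℕ)
    (pos : Fin (k + 1) → Condition T C) : Prop :=
  ∃ s : Strategy T C, ∀ p : ℕ → Condition T C, Monotone p →
    (∀ i : Fin (k + 1), p i = pos i) →
    (∀ j, k ≤ j → Even j → p (j + 1) = s.move j (fun i => p i)) → Wins T P p

/-- The condition `q` forces `P`. -/
def Forces [Nonempty C] {T : L.Theory} (q : Condition T C) (P : L.CStructure C → Prop) : Prop :=
  ∀ (k : ℕ) (pos : Fin (k + 1) → Condition T C), Monotone pos → q ≤ pos (Fin.last k) →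
    WinningPosition T P k pos

/-! ### Finite-generic and enforceable structures -/

/-- Canonical `L(C)`-structures: the interpretations of the constants from `C` are dense. -/
def Signature.CStructure.IsCanonical (B : L.CStructure C) : Prop := DenseRange B.const

/-- The set of `φ < r` true in `B⁺`, with `φ` a restricted quantifier-free `L(C)`-sentence. -/
def Signature.CStructure.appDiag (B : L.CStructure C) : Set (L.Expr C) :=
  {e | Signature.Formula.IsRestrictedQF e.1 ∧ (Signature.CSentence.val B e.1 : ℝ) < e.2}

/-- `B⁺` forces `φ < r` (with respect to `T`). -/
def Signature.CStructure.ForcesLT [Nonempty C] (B : L.CStructure C) (T : L.Theory)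
    (φ : L.CSentence C) (r : ℝ) : Prop :=
  ∃ q : Condition T C, q.1 ⊆ B.appDiag ∧
    Forces q fun A => (Signature.CSentence.val A φ : ℝ) < r

/-- Finite-generic⁺ `L(C)`-structures: canonical, and forcing agrees with truth. -/
def FiniteGenericPlus [Nonempty C] (T : L.Theory) (B : L.CStructure C) : Prop :=
  B.IsCanonical ∧ ∀ (φ : L.CSentence C) (r : ℝ), 0 < r →
    (B.ForcesLT T φ r ↔ (Signature.CSentence.val B φ : ℝ) < r)

/-- `B` is finite-generic with respect to `T`. -/
def FiniteGeneric (C : Type u) [Nonempty C] (T : L.Theory) (B : L.Structure) : Prop :=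
  ∃ c : C → B, FiniteGenericPlus T ⟨B, c⟩

/-- `A` is an enforceable structure with respect to `T`. -/
def EnforceableStructure (C : Type u) [Nonempty C] (T : L.Theory) (A : L.Structure) : Prop :=
  Enforceable (C := C) T fun E => Isomorphic E.reduct A

/-- `A` is the enforceable model of `T`: it is an enforceable model of `T`, and the only
enforceable structure up to isomorphism. -/
def IsTheEnforceableModel (C : Type u) [Nonempty C] (T : L.Theory) (A : L.Structure) : Prop :=
  A.Models T ∧ EnforceableStructure C T A ∧
    ∀ E : L.Structure, EnforceableStructure C T E → Isomorphic E A

end ContLogic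

end

noncomputable section

namespace ContLogic

open UniformSpace Filter Topology

variable {L : Signature.{u}} {C : Type u}

/-! ### Suprema and infima in the unit interval -/

/-! A condition is satisfied in `D` under some assignment of the constants: its failure under all
assignments would be a universal condition true in `D`, hence true in every model of the theory
(`exists_assignment`). Genericity adds that an open statement true in `D`, under an assignment
satisfying a condition `p`, can be ensured after extending `p` (`exists_ensurableBelow`). Countably
many tasks can be interleaved in one play (`ensurableSet_forall`), and countably many sentences test
elementary equivalence, so ∃ can make the compiled structure elementarily equivalent to `D`.

Primality enters through omitting types (`exists_isolating_condition`). Suppose that no condition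
pins down, up to `ε`, the type of some finite tuple `a` of `D`. Then ∃ can keep every tuple of
closed terms away from that type while building a structure elementarily equivalent to `D`. But `D`
embeds elementarily into this structure, and the image of `a` is a limit of tuples of closed terms,
a contradiction. Consequently any condition can be extended so that, whatever is played later, the
values in `D` of finitely many chosen constants need to move by less than `ε`
(`exists_isIsolating`).

This lets ∃ build a copy of `D`. She keeps an assignment in `D` satisfying the current condition,
with finitely many constants under control that move by less than `2⁻ᵐ` at stage `m`, and gives
fresh constants the values of a dense sequence. The limit assignment is dense and satisfies the
whole play (`ensurableSet_exists_denseRange`). A definitive play determines its compiled structure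
from any model with dense closed terms (`Definitive.exists_isIso`), so that structure is `D`.
Uniqueness holds because two enforceable properties can be won in a single play. -/

lemma coe_iSup_le_add {ι : Sort*} {f g : ι → unitInterval} {ε : ℝ} (hε : 0 ≤ ε)
    (h : ∀ i, (f i : ℝ) ≤ g i + ε) :
    ((⨆ i, f i : unitInterval) : ℝ) ≤ (⨆ i, g i : unitInterval) + ε := by
  by_contra hcon
  push Not at hcon
  let s : unitInterval := ⟨(⨆ i, g i : unitInterval) + ε, add_nonneg (unitInterval.nonneg _) hε,
    hcon.le.trans (unitInterval.le_one _)⟩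
  obtain ⟨i, hi⟩ := lt_iSup_iff.1 (show s < ⨆ i, f i from hcon)
  have h1 : (g i : ℝ) ≤ (⨆ i, g i : unitInterval) := Subtype.coe_le_coe.2 (le_iSup g i)
  have h2 : (⨆ i, g i : unitInterval) + ε < (f i : ℝ) := hi
  linarith [h i]

lemma coe_iInf_le_add {ι : Sort*} {f g : ι → unitInterval} {ε : ℝ} (hε : 0 ≤ ε)
    (h : ∀ i, (f i : ℝ) ≤ g i + ε) :
    ((⨅ i, f i : unitInterval) : ℝ) ≤ (⨅ i, g i : unitInterval) + ε := by
  by_contra hcon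
  push Not at hcon
  let s : unitInterval := ⟨(⨅ i, f i : unitInterval) - ε,
    by linarith [unitInterval.nonneg (⨅ i, g i)], by linarith [unitInterval.le_one (⨅ i, f i)]⟩
  obtain ⟨i, hi⟩ := iInf_lt_iff.1 (show (⨅ i, g i) < s from by
    change ((⨅ i, g i : unitInterval) : ℝ) < (⨅ i, f i : unitInterval) - ε
    linarith)
  have h1 : ((⨅ i, f i : unitInterval) : ℝ) ≤ f i := Subtype.coe_le_coe.2 (iInf_le f i)
  have h2 : (g i : ℝ) < (⨅ i, f i : unitInterval) - ε := hi
  linarith [h i]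

lemma unitInterval_dist_le_iff {a b : unitInterval} {ε : ℝ} :
    dist a b ≤ ε ↔ (a : ℝ) ≤ b + ε ∧ (b : ℝ) ≤ a + ε := by
  rw [Subtype.dist_eq, Real.dist_eq, abs_le]
  constructor <;> rintro ⟨h1, h2⟩ <;> constructor <;> linarith

lemma dist_iSup_le {ι : Sort*} {f g : ι → unitInterval} {ε : ℝ} (hε : 0 ≤ ε)
    (h : ∀ i, dist (f i) (g i) ≤ ε) : dist (⨆ i, f i) (⨆ i, g i) ≤ ε :=
  unitInterval_dist_le_iff.2
    ⟨coe_iSup_le_add hε fun i => (unitInterval_dist_le_iff.1 (h i)).1,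
      coe_iSup_le_add hε fun i => (unitInterval_dist_le_iff.1 (h i)).2⟩

lemma dist_iInf_le {ι : Sort*} {f g : ι → unitInterval} {ε : ℝ} (hε : 0 ≤ ε)
    (h : ∀ i, dist (f i) (g i) ≤ ε) : dist (⨅ i, f i) (⨅ i, g i) ≤ ε :=
  unitInterval_dist_le_iff.2
    ⟨coe_iInf_le_add hε fun i => (unitInterval_dist_le_iff.1 (h i)).1,
      coe_iInf_le_add hε fun i => (unitInterval_dist_le_iff.1 (h i)).2⟩

/-! ### Renaming of terms and formulas -/

def Signature.Term.map {α β : Type u} (f : α → β) : L.Term α → L.Term β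
  | .var a => .var (f a)
  | .func F ts => .func F fun i => (ts i).map f

lemma Signature.Term.realize_map {α β M : Type u} [PseudoMetricSpace M] [L.Prestructure M]
    (f : α → β) (v : β → M) (t : L.Term α) : (t.map f).realize v = t.realize (v ∘ f) := by
  induction t with
  | var a => rfl
  | func F ts ih => simp only [map, realize, ih]

lemma Signature.Term.map_map {α β γ : Type u} (f : α → β) (g : β → γ) (t : L.Term α) :
    (t.map f).map g = t.map (g ∘ f) := by
  induction t with
  | var a => rfl
  | func F ts ih => simp only [map, ih]

lemma Signature.Term.map_id {α : Type u} (t : L.Term α) : t.map id = t := by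
  induction t with
  | var a => rfl
  | func F ts ih => simp only [map, ih]

/-- Renaming of the constants of a formula. -/
def Signature.Formula.mapConst {α β : Type u} (f : α → β) :
    ∀ {n : ℕ}, L.Formula α n → L.Formula β n
  | _, .dist s t => .dist (s.map (Sum.map f id)) (t.map (Sum.map f id))
  | _, .pred P ts => .pred P fun i => (ts i).map (Sum.map f id)
  | _, .conn g φs => .conn g fun i => (φs i).mapConst f
  | _, .sup φ => .sup (φ.mapConst f)
  | _, .inf φ => .inf (φ.mapConst f)

lemma Signature.Formula.mapConst_mapConst {α β γ : Type u} (f : α → β) (g : β → γ) {n : ℕ}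
    (φ : L.Formula α n) : (φ.mapConst f).mapConst g = φ.mapConst (g ∘ f) := by
  induction φ with
  | dist s t => simp [mapConst, Signature.Term.map_map, Sum.map_comp_map]
  | pred P ts => simp [mapConst, Signature.Term.map_map, Sum.map_comp_map]
  | conn g φs ih => simp only [mapConst, ih]
  | sup φ ih => simp only [mapConst, ih]
  | inf φ ih => simp only [mapConst, ih]

lemma Signature.Formula.mapConst_id {α : Type u} {n : ℕ} (φ : L.Formula α n) :
    φ.mapConst id = φ := by
  induction φ with
  | dist s t => simp [mapConst, Signature.Term.map_id]
  | pred P ts => simp [mapConst, Signature.Term.map_id]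
  | conn g φs ih => simp only [mapConst, ih]
  | sup φ ih => simp only [mapConst, ih]
  | inf φ ih => simp only [mapConst, ih]

lemma Signature.Formula.realize_mapConst {α β M : Type u} [PseudoMetricSpace M] [L.Prestructure M]
    (f : α → β) (v : β → M) {n : ℕ} (φ : L.Formula α n) (x : Fin n → M) :
    (φ.mapConst f).realize v x = φ.realize (v ∘ f) x := by
  induction φ with
  | dist s t => simp [mapConst, realize, Signature.Term.realize_map, Sum.elim_comp_map]
  | pred P ts => simp [mapConst, realize, Signature.Term.realize_map, Sum.elim_comp_map]
  | conn g φs ih => simp only [mapConst, realize, ih]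
  | sup φ ih => simp only [mapConst, realize, ih]
  | inf φ ih => simp only [mapConst, realize, ih]

lemma Signature.Formula.IsAtomic.mapConst {α β : Type u} (f : α → β) {n : ℕ} {φ : L.Formula α n}
    (h : φ.IsAtomic) : (φ.mapConst f).IsAtomic := by
  cases h
  · exact .dist _ _
  · exact .pred _ _

lemma Signature.Formula.IsQF.mapConst {α β : Type u} (f : α → β) {n : ℕ} {φ : L.Formula α n}
    (h : φ.IsQF) : (φ.mapConst f).IsQF := by
  induction h with
  | atomic φ h => exact .atomic _ (h.mapConst f)
  | conn g φs _ ih => exact .conn _ _ ih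

lemma Signature.Formula.IsRestrictedQF.mapConst {α β : Type u} (f : α → β) {n : ℕ}
    {φ : L.Formula α n} (h : φ.IsRestrictedQF) : (φ.mapConst f).IsRestrictedQF := by
  induction h with
  | atomic φ h => exact .atomic _ (h.mapConst f)
  | half φ _ ih =>
    have : (Signature.Formula.conn halfConn ![φ]).mapConst f =
        .conn halfConn ![φ.mapConst f] := by
      simp only [Signature.Formula.mapConst]; congr 1; ext i; fin_cases i; rfl
    rw [this]; exact .half _ ih
  | neg φ _ ih =>
    have : (Signature.Formula.conn negConn ![φ]).mapConst f =
        .conn negConn ![φ.mapConst f] := by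
      simp only [Signature.Formula.mapConst]; congr 1; ext i; fin_cases i; rfl
    rw [this]; exact .neg _ ih
  | add φ ψ _ _ ih1 ih2 =>
    have : (Signature.Formula.conn addConn ![φ, ψ]).mapConst f =
        .conn addConn ![φ.mapConst f, ψ.mapConst f] := by
      simp only [Signature.Formula.mapConst]; congr 1; ext i; fin_cases i <;> rfl
    rw [this]; exact .add _ _ ih1 ih2

lemma Signature.Formula.IsRestrictedQF.isQF {α : Type u} {n : ℕ}
    {φ : L.Formula α n} (h : φ.IsRestrictedQF) : φ.IsQF := by
  induction h with
  | atomic φ h => exact .atomic _ h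
  | half φ _ ih => exact .conn _ _ fun i => by fin_cases i; exact ih
  | neg φ _ ih => exact .conn _ _ fun i => by fin_cases i; exact ih
  | add φ ψ _ _ ih1 ih2 => exact .conn _ _ fun i => by fin_cases i; exacts [ih1, ih2]

/-! ### Replacing constants by variables -/

def substVar {α β : Type u} {m : ℕ} (ρ : α → β ⊕ Fin m) (n : ℕ) :
    α ⊕ Fin n → β ⊕ Fin (m + n) :=
  Sum.elim (fun a => (ρ a).map id (Fin.castAdd n)) fun i => .inr (Fin.natAdd m i)

/-- Replace each constant `a` by the constant or the variable `ρ a`; the variables of the formula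
are shifted by `m`. -/
def Signature.Formula.subst {α β : Type u} {m : ℕ} (ρ : α → β ⊕ Fin m) :
    ∀ {n : ℕ}, L.Formula α n → L.Formula β (m + n)
  | n, .dist s t => .dist (s.map (substVar ρ n)) (t.map (substVar ρ n))
  | n, .pred P ts => .pred P fun i => (ts i).map (substVar ρ n)
  | _, .conn g φs => .conn g fun i => (φs i).subst ρ
  | _, .sup φ => .sup (φ.subst ρ)
  | _, .inf φ => .inf (φ.subst ρ)

lemma elim_append_comp_substVar {α β M : Type u} {m n : ℕ} (ρ : α → β ⊕ Fin m) (v : β → M)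
    (z : Fin m → M) (x : Fin n → M) :
    Sum.elim v (Fin.append z x) ∘ substVar ρ n = Sum.elim (Sum.elim v z ∘ ρ) x := by
  ext (a | i)
  · rcases h : ρ a with b | j <;> simp [substVar, h]
  · simp [substVar]

lemma Signature.Formula.realize_subst {α β M : Type u} [PseudoMetricSpace M] [L.Prestructure M]
    {m n : ℕ} (ρ : α → β ⊕ Fin m) (v : β → M) (z : Fin m → M)
    (φ : L.Formula α n) (x : Fin n → M) :
    (φ.subst ρ).realize v (Fin.append z x) = φ.realize (Sum.elim v z ∘ ρ) x := by
  induction φ with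
  | dist s t => simp [subst, realize, Signature.Term.realize_map, elim_append_comp_substVar]
  | pred P ts => simp [subst, realize, Signature.Term.realize_map, elim_append_comp_substVar]
  | conn g φs ih => simp only [subst, realize, ih]
  | sup φ ih =>
    simp only [subst, realize]
    exact iSup_congr fun a => by rw [← ih, Fin.append_snoc]
  | inf φ ih =>
    simp only [subst, realize]
    exact iInf_congr fun a => by rw [← ih, Fin.append_snoc]

lemma Signature.Formula.IsQF.subst {α β : Type u} {m n : ℕ} (ρ : α → β ⊕ Fin m)
    {φ : L.Formula α n} (h : φ.IsQF) : (φ.subst ρ).IsQF := by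
  induction h with
  | atomic φ h =>
    refine .atomic _ ?_
    cases h
    · exact .dist _ _
    · exact .pred _ _
  | conn g φs _ ih => exact .conn _ _ ih

/-- `sup_{x_0} ⋯ sup_{x_{n-1}} φ`. -/
def Signature.Formula.sups {α : Type u} : ∀ {n : ℕ}, L.Formula α n → L.Formula α 0
  | 0, φ => φ
  | _ + 1, φ => (Signature.Formula.sup φ).sups

lemma Signature.Formula.realize_sups {α M : Type u} [PseudoMetricSpace M] [L.Prestructure M]
    (v : α → M) : ∀ {n : ℕ} (φ : L.Formula α n),
    φ.sups.realize v Fin.elim0 = ⨆ z : Fin n → M, φ.realize v z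
  | 0, φ => by
    simp only [sups]
    exact le_antisymm (le_iSup (fun z => φ.realize v z) Fin.elim0)
      (iSup_le fun z => by rw [Subsingleton.elim z Fin.elim0])
  | n + 1, φ => by
    rw [sups, realize_sups]
    simp only [realize]
    refine le_antisymm (iSup_le fun z => iSup_le fun a => le_iSup (fun z => φ.realize v z) _)
      (iSup_le fun z => ?_)
    obtain ⟨z, a, rfl⟩ : ∃ z' a, z = Fin.snoc z' a := ⟨_, _, (Fin.snoc_init_self z).symm⟩
    exact le_iSup_of_le z (le_iSup (fun a => φ.realize v (Fin.snoc z a)) a)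

lemma isUniversal_sups {α : Type u} : ∀ {n : ℕ} {φ : L.Formula α n},
    φ.IsUniversal → φ.sups.IsUniversal
  | 0, _, h => h
  | _ + 1, φ, h => isUniversal_sups (φ := .sup φ) (.sup φ h)

/-! ### Finite support and uniform continuity of formulas -/

lemma Signature.Term.exists_modulus {α : Type u} (t : L.Term α) :
    ∃ F : Set α, F.Finite ∧ ∀ ε > 0, ∀ᶠ δ in 𝓝[>] (0 : ℝ),
      ∀ (M : Type u) [PseudoMetricSpace M] [L.Prestructure M] (v w : α → M),
        (∀ a ∈ F, dist (v a) (w a) < δ) → dist (t.realize v) (t.realize w) < ε := by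
  induction t with
  | var a =>
    refine ⟨{a}, Set.finite_singleton a, fun ε hε => ?_⟩
    filter_upwards [Ioo_mem_nhdsGT hε] with δ hδ M _ _ v w h
    exact (h a rfl).trans hδ.2
  | @func n f ts ih =>
    choose F hF h using ih
    refine ⟨⋃ i, F i, Set.finite_iUnion hF, fun ε hε => ?_⟩
    have hmod := L.funcMod_pos f (ε / 2) (half_pos hε)
    filter_upwards [eventually_all.2 fun i => h i _ hmod] with δ hδ M _ _ v w hvw
    refine (Signature.Prestructure.func_uc f (ε / 2) (half_pos hε) _ _ ?_).trans_lt
      (half_lt_self hε)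
    exact (dist_pi_lt_iff hmod).2 fun i => hδ i M v w fun a ha => hvw a (Set.mem_iUnion.2 ⟨i, ha⟩)

/-- The modulus does not depend on the structure, so a bound arranged in `D` also applies to a
compiled structure. Stating it for all small `δ` lets the finitely many requirements of subformulas
be met at once by filters. -/
lemma formula_exists_modulus {α : Type u} {n : ℕ} (φ : L.Formula α n) :
    ∃ F : Set α, F.Finite ∧ ∀ ε > 0, ∀ᶠ δ in 𝓝[>] (0 : ℝ),
      ∀ (M : Type u) [PseudoMetricSpace M] [L.Prestructure M] (v w : α → M) (x y : Fin n → M),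
        (∀ a ∈ F, dist (v a) (w a) < δ) → (∀ i, dist (x i) (y i) < δ) →
          dist (φ.realize v x) (φ.realize w y) < ε := by
  induction φ with
  | dist s t =>
    obtain ⟨F, hF, hs⟩ := s.exists_modulus
    obtain ⟨G, hG, ht⟩ := t.exists_modulus
    refine ⟨Sum.inl ⁻¹' (F ∪ G),
      (hF.union hG).preimage Sum.inl_injective.injOn, fun ε hε => ?_⟩
    filter_upwards [hs _ (half_pos hε), ht _ (half_pos hε)] with δ h1 h2 M _ _ v w x y hv hx
    have key : ∀ a ∈ F ∪ G, dist (Sum.elim v x a) (Sum.elim w y a) < δ := by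
      rintro (a | i) ha
      exacts [hv a ha, hx i]
    have e1 := h1 M _ _ fun a ha => key a (.inl ha)
    have e2 := h2 M _ _ fun a ha => key a (.inr ha)
    rw [Subtype.dist_eq, Real.dist_eq]
    refine (abs_le.2 ?_ : _ ≤ dist (s.realize (Sum.elim v x)) (s.realize (Sum.elim w y)) +
      dist (t.realize (Sum.elim v x)) (t.realize (Sum.elim w y))).trans_lt (by linarith)
    simp only [Signature.Formula.realize]
    constructor
    · have := dist_triangle4 (s.realize (Sum.elim w y)) (s.realize (Sum.elim v x))
        (t.realize (Sum.elim v x)) (t.realize (Sum.elim w y))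
      rw [dist_comm (s.realize (Sum.elim w y)) (s.realize (Sum.elim v x))] at this
      linarith
    · have := dist_triangle4 (s.realize (Sum.elim v x)) (s.realize (Sum.elim w y))
        (t.realize (Sum.elim w y)) (t.realize (Sum.elim v x))
      rw [dist_comm (t.realize (Sum.elim w y)) (t.realize (Sum.elim v x))] at this
      linarith
  | @pred n k P ts =>
    choose F hF h using fun i => (ts i).exists_modulus
    refine ⟨Sum.inl ⁻¹' (⋃ i, F i),
      (Set.finite_iUnion hF).preimage Sum.inl_injective.injOn, fun ε hε => ?_⟩
    have hmod := L.predMod_pos P (ε / 2) (half_pos hε)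
    filter_upwards [eventually_all.2 fun i => h i _ hmod] with δ hδ M _ _ v w x y hv hx
    refine (Signature.Prestructure.pred_uc P (ε / 2) (half_pos hε) _ _ ?_).trans_lt
      (half_lt_self hε)
    refine (dist_pi_lt_iff hmod).2 fun i => hδ i M _ _ ?_
    rintro (a | j) ha
    exacts [hv a (Set.mem_iUnion.2 ⟨i, ha⟩), hx j]
  | @conn n k g φs ih =>
    choose F hF h using ih
    refine ⟨⋃ i, F i, Set.finite_iUnion hF, fun ε hε => ?_⟩
    obtain ⟨η, hη, hg⟩ := Metric.uniformContinuous_iff.1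
      (CompactSpace.uniformContinuous_of_continuous g.continuous) ε hε
    filter_upwards [eventually_all.2 fun i => h i _ hη] with δ hδ M _ _ v w x y hv hx
    refine hg ((dist_pi_lt_iff hη).2 fun i => hδ i M v w x y (fun a ha => ?_) hx)
    exact hv a (Set.mem_iUnion.2 ⟨i, ha⟩)
  | @sup n φ ih =>
    obtain ⟨F, hF, h⟩ := ih
    refine ⟨F, hF, fun ε hε => ?_⟩
    filter_upwards [h _ (half_pos hε), self_mem_nhdsWithin] with δ hδ hpos M _ _ v w x y hv hx
    refine (dist_iSup_le (half_pos hε).le fun a => (hδ M v w _ _ hv ?_).le).trans_lt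
      (half_lt_self hε)
    -- The quantified variable has the same value on both sides, so only `0 < δ` is needed for it.
    refine Fin.lastCases ?_ fun i => ?_
    · simpa using hpos
    · simpa using hx i
  | @inf n φ ih =>
    obtain ⟨F, hF, h⟩ := ih
    refine ⟨F, hF, fun ε hε => ?_⟩
    filter_upwards [h _ (half_pos hε), self_mem_nhdsWithin] with δ hδ hpos M _ _ v w x y hv hx
    refine (dist_iInf_le (half_pos hε).le fun a => (hδ M v w _ _ hv ?_).le).trans_lt
      (half_lt_self hε)
    refine Fin.lastCases ?_ fun i => ?_
    · simpa using hpos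
    · simpa using hx i

/-- The value of a formula without free variables depends on finitely many constants, uniformly
continuously. -/
lemma sentence_exists_modulus {α : Type u} (φ : L.Formula α 0) :
    ∃ F : Set α, F.Finite ∧ ∀ ε > 0, ∃ δ > (0 : ℝ),
      ∀ (M : Type u) [PseudoMetricSpace M] [L.Prestructure M] (v w : α → M),
        (∀ a ∈ F, dist (v a) (w a) < δ) →
          dist (φ.realize v Fin.elim0) (φ.realize w Fin.elim0) < ε := by
  obtain ⟨F, hF, h⟩ := formula_exists_modulus φ
  refine ⟨F, hF, fun ε hε => ?_⟩
  obtain ⟨δ, h1, h2⟩ := ((h ε hε).and self_mem_nhdsWithin).exists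
  exact ⟨δ, h2, fun M _ _ v w hvw => h1 M v w _ _ hvw fun i => i.elim0⟩

lemma sentence_exists_support {α : Type u} (φ : L.Formula α 0) :
    ∃ F : Set α, F.Finite ∧
      ∀ (M : Type u) [PseudoMetricSpace M] [L.Prestructure M] (v w : α → M),
        (∀ a ∈ F, v a = w a) → φ.realize v Fin.elim0 = φ.realize w Fin.elim0 := by
  obtain ⟨F, hF, h⟩ := sentence_exists_modulus φ
  refine ⟨F, hF, fun M _ _ v w hvw => dist_le_zero.1 (le_of_forall_pos_lt_add fun ε hε => ?_)⟩
  obtain ⟨δ, hδ, hd⟩ := h ε hε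
  rw [zero_add]
  exact hd M v w fun a ha => by rw [hvw a ha, dist_self]; exact hδ

lemma continuous_realize {α M : Type u} [PseudoMetricSpace M] [L.Prestructure M]
    (φ : L.Formula α 0) : Continuous fun v : α → M => φ.realize v Fin.elim0 := by
  obtain ⟨F, hF, h⟩ := sentence_exists_modulus φ
  refine continuous_iff_continuousAt.2 fun v => Metric.tendsto_nhds.2 fun ε hε => ?_
  obtain ⟨δ, hδ, hd⟩ := h ε hε
  have : ∀ᶠ w in 𝓝 v, ∀ a ∈ F, dist (w a) (v a) < δ :=
    (eventually_all_finite hF).2 fun a _ =>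
      (continuous_apply a).continuousAt.eventually (Metric.ball_mem_nhds (v a) hδ)
  filter_upwards [this] with w hw
  exact hd M w v hw

lemma Signature.Term.exists_support {α : Type u} (t : L.Term α) :
    ∃ F : Set α, F.Finite ∧
      ∀ (M : Type u) [PseudoMetricSpace M] [L.Prestructure M] (v w : α → M),
        (∀ a ∈ F, v a = w a) → t.realize v = t.realize w := by
  induction t with
  | var a => exact ⟨{a}, Set.finite_singleton a, fun M _ _ v w h => h a rfl⟩
  | func f ts ih =>
    choose F hF h using ih
    refine ⟨⋃ i, F i, Set.finite_iUnion hF, fun M _ _ v w hvw => ?_⟩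
    simp only [Signature.Term.realize]
    congr 1
    ext i
    exact h i M v w fun a ha => hvw a (Set.mem_iUnion.2 ⟨i, ha⟩)

/-! ### Auxiliary connectives -/

/-- The connective `t ↦ r - t`, truncated to `[0,1]`. -/
def gapConn (r : ℝ) : Connective 1 where
  toFun x := Set.projIcc 0 1 zero_le_one (r - x 0)
  continuous_toFun := by fun_prop

def minConn : Connective 2 where
  toFun x := x 0 ⊓ x 1
  continuous_toFun := by fun_prop

lemma le_gapConn_iff {r : ℝ} {x : Fin 1 → unitInterval} {s : unitInterval} (hs : 0 < s) :
    s ≤ gapConn r x ↔ (x 0 : ℝ) + s ≤ r := by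
  have hs' : (0 : ℝ) < s := hs
  have hs1 := s.2.2
  change (s : ℝ) ≤ max 0 (min 1 (r - x 0)) ↔ _
  rw [le_max_iff, le_min_iff]
  constructor
  · rintro (h | h)
    · linarith
    · linarith [h.2]
  · exact fun h => .inr ⟨hs1, by linarith⟩

lemma gapConn_pos_iff {r : ℝ} {x : Fin 1 → unitInterval} :
    0 < gapConn r x ↔ (x 0 : ℝ) < r := by
  change (0 : ℝ) < max 0 (min 1 (r - x 0)) ↔ _
  rw [lt_max_iff, lt_min_iff]
  constructor
  · rintro (h | h)
    · exact absurd h (lt_irrefl _)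
    · linarith [h.2]
  · exact fun h => .inr ⟨one_pos, by linarith⟩

/-! ### Formulas for finite sets of open conditions and for projections -/

/-- The degree to which a finite set of expressions `φ < r` holds is given by a formula. -/
lemma exists_degree_formula {α : Type u} {p : Set (L.Formula α 0 × ℝ)} (hp : p.Finite) :
    ∃ γ : L.Formula α 0, ((∀ e ∈ p, e.1.IsQF) → γ.IsQF) ∧
      ∀ (M : Type u) [PseudoMetricSpace M] [L.Prestructure M] (v : α → M),
        (∀ s : unitInterval, 0 < s →
          (s ≤ γ.realize v Fin.elim0 ↔ ∀ e ∈ p, (e.1.realize v Fin.elim0 : ℝ) + s ≤ e.2)) ∧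
        (0 < γ.realize v Fin.elim0 ↔ ∀ e ∈ p, (e.1.realize v Fin.elim0 : ℝ) < e.2) := by
  induction p, hp using Set.Finite.induction_on with
  | empty =>
    refine ⟨.conn (k := 0) (ContinuousMap.const _ 1) Fin.elim0,
      fun _ => .conn _ _ fun i => i.elim0, fun M _ _ v => ⟨fun s _ => ?_, ?_⟩⟩
    · simpa [Signature.Formula.realize] using unitInterval.le_one'
    · simp [Signature.Formula.realize]
  | @insert e p _ _ ih =>
    obtain ⟨γ, hγ, h⟩ := ih
    refine ⟨.conn minConn ![.conn (gapConn e.2) ![e.1], γ], fun hq => ?_, fun M _ _ v => ?_⟩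
    · refine .conn _ _ fun i => ?_
      fin_cases i
      · exact .conn _ _ fun i => by fin_cases i; exact hq e (Set.mem_insert _ _)
      · exact hγ fun e' he' => hq e' (Set.mem_insert_of_mem _ he')
    · have hval : (Signature.Formula.conn minConn ![.conn (gapConn e.2) ![e.1], γ]).realize v
          Fin.elim0 = gapConn e.2 (fun _ => e.1.realize v Fin.elim0) ⊓ γ.realize v Fin.elim0 := by
        simp only [Signature.Formula.realize, minConn]
        congr 1
      rw [hval]
      refine ⟨fun s hs => ?_, ?_⟩
      · rw [le_inf_iff, le_gapConn_iff hs, (h M v).1 s hs, Set.forall_mem_insert]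
      · rw [lt_inf_iff, gapConn_pos_iff, (h M v).2, Set.forall_mem_insert]

/-- Quantifying out the constants from `α`. -/
lemma exists_sup_formula {α β : Type u} [Nonempty α] (Γ : L.Formula (α ⊕ β) 0) :
    ∃ ψ : L.Formula β 0, (Γ.IsQF → ψ.IsUniversal) ∧
      ∀ (M : Type u) [PseudoMetricSpace M] [L.Prestructure M] (y : β → M),
        ψ.realize y Fin.elim0 = ⨆ e : α → M, Γ.realize (Sum.elim e y) Fin.elim0 := by
  classical
  obtain ⟨F, hF, hsupp⟩ := sentence_exists_support Γ
  obtain ⟨a₀⟩ := ‹Nonempty α›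
  -- Only the constants in the support have to be quantified. Adding `a₀` makes `G` nonempty, so
  -- that `κ` can send the irrelevant constants somewhere.
  let G : Finset α := insert a₀ (hF.preimage Sum.inl_injective.injOn).toFinset
  have hG : ∀ a, Sum.inl a ∈ F → a ∈ G := fun a ha =>
    Finset.mem_insert_of_mem (by simpa using ha)
  let κ : α → Fin G.card := fun a =>
    if h : a ∈ G then G.equivFin ⟨a, h⟩ else G.equivFin ⟨a₀, Finset.mem_insert_self _ _⟩
  let ρ : α ⊕ β → β ⊕ Fin G.card := Sum.elim (fun a => .inr (κ a)) .inl
  have hρ : ∀ (M : Type u) (y : β → M) (z : Fin G.card → M),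
      Sum.elim y z ∘ ρ = Sum.elim (z ∘ κ) y := by
    intro M y z
    ext (a | b) <;> rfl
  let φ : L.Formula β G.card := Γ.subst ρ
  refine ⟨φ.sups, fun h => isUniversal_sups (.qf _ (h.subst ρ)), fun M _ _ y => ?_⟩
  have hφ : ∀ z : Fin G.card → M,
      φ.realize y z = Γ.realize (Sum.elim (z ∘ κ) y) Fin.elim0 := fun z => by
    rw [← hρ, ← Signature.Formula.realize_subst]
    congr 1
    ext i
    exact (Fin.append_left z Fin.elim0 i).symm
  rw [Signature.Formula.realize_sups]
  refine le_antisymm (iSup_le fun z => ?_) (iSup_le fun e => ?_)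
  · rw [hφ]
    exact le_iSup (fun e : α → M => Γ.realize (Sum.elim e y) Fin.elim0) _
  · refine le_iSup_of_le (fun i => e (G.equivFin.symm i)) ?_
    rw [hφ]
    refine (hsupp M _ _ ?_).le
    rintro (a | b) hab
    · simp [κ, hG a hab]
    · rfl

/-- The value of a closed term. -/
def termVal {M : Type u} [PseudoMetricSpace M] [L.Prestructure M] (e : C → M) (t : L.CTerm C) : M :=
  t.realize (Sum.elim e Fin.elim0)

/-- The degree of a finite set of open conditions is a minimum of gaps. The version with a threshold
`s` is a closed condition; it survives suprema that are not attained and passes between structures.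
-/
lemma exists_near_formula {K : Type u} [Finite K] (Γ₀ : L.Formula (C ⊕ K) 0) (t : K → L.CTerm C)
    (ε : ℝ) : ∃ Γ : L.Formula (C ⊕ K) 0,
      ∀ (M : Type u) [PseudoMetricSpace M] [L.Prestructure M] (e : C → M) (y : K → M),
        (∀ s : unitInterval, 0 < s → (s ≤ Γ.realize (Sum.elim e y) Fin.elim0 ↔
          s ≤ Γ₀.realize (Sum.elim e y) Fin.elim0 ∧ ∀ i, dist (termVal e (t i)) (y i) + s ≤ ε)) ∧
        (0 < Γ.realize (Sum.elim e y) Fin.elim0 ↔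
          0 < Γ₀.realize (Sum.elim e y) Fin.elim0 ∧ ∀ i, dist (termVal e (t i)) (y i) < ε) := by
  obtain ⟨γ, -, h⟩ := exists_degree_formula (L := L) (Set.finite_range fun i : K =>
    ((.dist ((t i).map (Sum.map .inl id)) (.var (.inl (.inr i))), ε) : L.Formula (C ⊕ K) 0 × ℝ))
  refine ⟨.conn minConn ![Γ₀, γ], fun M _ _ e y => ?_⟩
  have hval : (Signature.Formula.conn minConn ![Γ₀, γ]).realize (Sum.elim e y) Fin.elim0 =
      Γ₀.realize (Sum.elim e y) Fin.elim0 ⊓ γ.realize (Sum.elim e y) Fin.elim0 := by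
    simp [Signature.Formula.realize, minConn]
  have hd : ∀ i, ((Signature.Formula.dist ((t i).map (Sum.map .inl id)) (.var (.inl (.inr i))) :
      L.Formula (C ⊕ K) 0).realize (Sum.elim e y) Fin.elim0 : ℝ) =
      dist (termVal e (t i)) (y i) := fun i => by
    simp [Signature.Formula.realize, Signature.Term.realize_map, termVal, Sum.elim_comp_map,
      Signature.Term.realize]
  rw [hval]
  refine ⟨fun s hs => ?_, ?_⟩
  · rw [le_inf_iff, (h M _).1 s hs, Set.forall_mem_range]
    simp only [hd]
  · rw [lt_inf_iff, (h M _).2, Set.forall_mem_range]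
    simp only [hd]

/-- `ψ` holds at a tuple close to the values of the terms `t`. -/
lemma exists_near_terms_formula {K : Type u} [Finite K] [Nonempty K] (ψ : L.Formula K 0)
    (t : K → L.CTerm C) (ε : ℝ) : ∃ γ : L.CSentence C,
      ∀ (M : Type u) [PseudoMetricSpace M] [L.Prestructure M] (e : C → M),
        (∀ (s : unitInterval) (y : K → M), 0 < s → s ≤ ψ.realize y Fin.elim0 →
          (∀ i, dist (termVal e (t i)) (y i) + s ≤ ε) → s ≤ γ.realize e Fin.elim0) ∧
        (0 < γ.realize e Fin.elim0 → ∃ y : K → M, 0 < ψ.realize y Fin.elim0 ∧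
          ∀ i, dist (termVal e (t i)) (y i) < ε) := by
  obtain ⟨Γ, hΓ⟩ := exists_near_formula (ψ.mapConst Sum.inr) t ε
  obtain ⟨γ, -, hγ⟩ := exists_sup_formula (Γ.mapConst Sum.swap : L.Formula (K ⊕ C) 0)
  have hsw : ∀ (M : Type u) (e : C → M) (y : K → M), Sum.elim y e ∘ Sum.swap = Sum.elim e y := by
    intro M e y
    ext (a | b) <;> rfl
  refine ⟨γ, fun M _ _ e => ?_⟩
  rw [hγ]
  simp only [Signature.Formula.realize_mapConst, hsw]
  have hψ : ∀ y : K → M, (ψ.mapConst Sum.inr).realize (Sum.elim e y) Fin.elim0 =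
      ψ.realize y Fin.elim0 := fun y => by
    rw [Signature.Formula.realize_mapConst, Sum.elim_comp_inr]
  refine ⟨fun s y hs h1 h2 => ?_, fun h => ?_⟩
  · refine le_iSup_of_le y (((hΓ M e y).1 s hs).2 ⟨?_, h2⟩)
    rwa [hψ]
  · obtain ⟨y, hy⟩ := lt_iSup_iff.1 h
    obtain ⟨h1, h2⟩ := (hΓ M e y).2.1 hy
    exact ⟨y, by rwa [hψ] at h1, h2⟩

/-- `γ` holds for some choice of the constants such that the values of the terms `t` are close to
the given tuple. -/
lemma exists_near_tuple_formula [Nonempty C] {K : Type u} [Finite K] (γ : L.CSentence C)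
    (t : K → L.CTerm C) (ε : ℝ) : ∃ ψ : L.Formula K 0,
      ∀ (M : Type u) [PseudoMetricSpace M] [L.Prestructure M] (y : K → M),
        (∀ (s : unitInterval) (e : C → M), 0 < s → s ≤ γ.realize e Fin.elim0 →
          (∀ i, dist (termVal e (t i)) (y i) + s ≤ ε) → s ≤ ψ.realize y Fin.elim0) ∧
        (0 < ψ.realize y Fin.elim0 ↔ ∃ e : C → M, 0 < γ.realize e Fin.elim0 ∧
          ∀ i, dist (termVal e (t i)) (y i) < ε) := by
  obtain ⟨Γ, hΓ⟩ := exists_near_formula (K := K) (γ.mapConst Sum.inl) t ε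
  obtain ⟨ψ, -, hψ⟩ := exists_sup_formula Γ
  refine ⟨ψ, fun M _ _ y => ?_⟩
  rw [hψ]
  have hγ : ∀ e : C → M, (γ.mapConst Sum.inl).realize (Sum.elim e y) Fin.elim0 =
      γ.realize e Fin.elim0 := fun e => by
    rw [Signature.Formula.realize_mapConst, Sum.elim_comp_inl]
  refine ⟨fun s e hs h1 h2 => ?_, fun h => ?_, fun ⟨e, h1, h2⟩ => ?_⟩
  · refine le_iSup_of_le e (((hΓ M e y).1 s hs).2 ⟨?_, h2⟩)
    rwa [hγ]
  · obtain ⟨e, he⟩ := lt_iSup_iff.1 h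
    obtain ⟨h1, h2⟩ := (hΓ M e y).2.1 he
    exact ⟨e, by rwa [hγ] at h1, h2⟩
  · exact lt_iSup_iff.2 ⟨e, (hΓ M e y).2.2 ⟨by rwa [hγ], h2⟩⟩

/-! ### Countability -/

/-- Terms as well-founded trees. -/
def Signature.Term.toWType {α : Type u} : L.Term α →
    WType fun x : α ⊕ (Σ n, L.Func n) => Sum.elim (fun _ => Fin 0) (fun f => Fin f.1) x
  | .var a => .mk (.inl a) Fin.elim0
  | .func f ts => .mk (.inr ⟨_, f⟩) fun i => (ts i).toWType

lemma Signature.Term.toWType_injective {α : Type u} :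
    Function.Injective (Signature.Term.toWType (L := L) (α := α)) := by
  intro s
  induction s with
  | var a =>
    rintro (b | ⟨f, ts⟩) h
    · injection h with h1 _
      injection h1 with h1
      rw [h1]
    · injection h with h1 _
      cases h1
  | func f ts ih =>
    rintro (b | ⟨g, us⟩) h
    · injection h with h1 _
      cases h1
    · injection h with h1 h2
      cases h1
      congr 1
      ext i
      exact ih i (congrFun (eq_of_heq h2) i)

instance countable_term [∀ n, Countable (L.Func n)] {α : Type u} [Countable α] :
    Countable (L.Term α) := by
  have := Encodable.ofCountable (α ⊕ (Σ n, L.Func n))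
  have : ∀ x : α ⊕ (Σ n, L.Func n),
      Fintype (Sum.elim (fun _ => Fin 0) (fun f => Fin f.1) x : Type) := by
    rintro (a | f) <;> simp only [Sum.elim_inl, Sum.elim_inr] <;> infer_instance
  have : ∀ x : α ⊕ (Σ n, L.Func n),
      Encodable (Sum.elim (fun _ => Fin 0) (fun f => Fin f.1) x : Type) := by
    rintro (a | f) <;> simp only [Sum.elim_inl, Sum.elim_inr] <;> infer_instance
  exact Signature.Term.toWType_injective.countable

/-- Formulas of bounded depth with connectives from a given family. -/
def formulasOver (α : Type u) (G : ∀ k, Set (Connective k)) : ℕ → ∀ n, Set (L.Formula α n)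
  | 0, _ => (Set.range fun x : L.Term _ × L.Term _ => .dist x.1 x.2) ∪
      ⋃ k, Set.range fun x : L.Pred k × (Fin k → L.Term _) => .pred x.1 x.2
  | d + 1, n => formulasOver α G d n ∪
      (⋃ k, (fun x : Connective k × (Fin k → L.Formula α n) => .conn x.1 x.2) ''
        (G k ×ˢ {φs | ∀ i, φs i ∈ formulasOver α G d n})) ∪
      (.sup '' formulasOver α G d (n + 1) ∪ .inf '' formulasOver α G d (n + 1))

lemma countable_formulasOver [∀ n, Countable (L.Func n)] [∀ n, Countable (L.Pred n)]
    {α : Type u} [Countable α] {G : ∀ k, Set (Connective k)} (hG : ∀ k, (G k).Countable) :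
    ∀ d n, (formulasOver (L := L) α G d n).Countable
  | 0, _ => (Set.countable_range _).union (Set.countable_iUnion fun _ => Set.countable_range _)
  | d + 1, n => ((countable_formulasOver hG d n).union (Set.countable_iUnion fun k =>
      ((hG k).prod (Set.countable_pi fun _ => countable_formulasOver hG d n)).image _)).union
      (((countable_formulasOver hG d _).image _).union ((countable_formulasOver hG d _).image _))

lemma formulasOver_mono (α : Type u) (G : ∀ k, Set (Connective k)) (n : ℕ) :
    Monotone fun d => formulasOver (L := L) α G d n :=
  monotone_nat_of_le_succ fun _ => Set.subset_union_left.trans Set.subset_union_left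

/-- Connectives are uniformly continuous on a cube, so errors in subformulas and in the connective
itself both stay small; quantifiers do not increase the uniform distance. -/
lemma exists_formulasOver_near {α : Type u} {G : ∀ k, Set (Connective k)} (hG : ∀ k, Dense (G k))
    {n : ℕ} (φ : L.Formula α n) : ∀ ε > 0, ∃ d, ∃ ψ ∈ formulasOver (L := L) α G d n,
      ∀ (M : Type u) [PseudoMetricSpace M] [L.Prestructure M] (v : α → M) (x : Fin n → M),
        dist (φ.realize v x) (ψ.realize v x) ≤ ε := by
  induction φ with
  | dist s t =>
    exact fun ε hε => ⟨0, _, .inl ⟨(s, t), rfl⟩, fun M _ _ v x => by simp [hε.le]⟩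
  | pred P ts =>
    exact fun ε hε => ⟨0, _, .inr (Set.mem_iUnion.2 ⟨_, (P, ts), rfl⟩),
      fun M _ _ v x => by simp [hε.le]⟩
  | @conn n k g φs ih =>
    intro ε hε
    obtain ⟨η, hη, hg⟩ := Metric.uniformContinuous_iff.1
      (CompactSpace.uniformContinuous_of_continuous g.continuous) (ε / 2) (half_pos hε)
    choose d ψ hψ h using fun i => ih i (η / 2) (half_pos hη)
    obtain ⟨g', hg', hgg'⟩ := (hG k).exists_dist_lt g (half_pos hε)
    obtain ⟨N, hN⟩ := (Set.finite_range d).bddAbove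
    refine ⟨N + 1, .conn g' ψ, .inl (.inr (Set.mem_iUnion.2 ⟨k, (g', ψ), ⟨hg', fun i => ?_⟩, rfl⟩)),
      fun M _ _ v x => ?_⟩
    · exact formulasOver_mono α G n (hN ⟨i, rfl⟩) (hψ i)
    · simp only [Signature.Formula.realize]
      refine (dist_triangle _ (g fun i => (ψ i).realize v x) _).trans ?_
      have h1 : dist (g fun i => (φs i).realize v x) (g fun i => (ψ i).realize v x) < ε / 2 :=
        hg ((dist_pi_lt_iff hη).2 fun i => (h i M v x).trans_lt (half_lt_self hη))
      have h2 := ContinuousMap.dist_apply_le_dist (f := g) (g := g') fun i => (ψ i).realize v x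
      linarith
  | sup φ ih =>
    intro ε hε
    obtain ⟨d, ψ, hψ, h⟩ := ih ε hε
    exact ⟨d + 1, .sup ψ, .inr (.inl ⟨ψ, hψ, rfl⟩), fun M _ _ v x =>
      dist_iSup_le hε.le fun a => h M v _⟩
  | inf φ ih =>
    intro ε hε
    obtain ⟨d, ψ, hψ, h⟩ := ih ε hε
    exact ⟨d + 1, .inf ψ, .inr (.inr ⟨ψ, hψ, rfl⟩), fun M _ _ v x =>
      dist_iInf_le hε.le fun a => h M v _⟩

/-- Countably many sentences suffice to test elementary equivalence. -/
lemma exists_countable_elementarilyEquivalent [∀ n, Countable (L.Func n)]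
    [∀ n, Countable (L.Pred n)] : ∃ S : Set L.Sentence, S.Countable ∧ ∀ A B : L.Structure,
      (∀ σ ∈ S, Signature.Sentence.val A σ = Signature.Sentence.val B σ) →
        ElementarilyEquivalent A B := by
  choose G hGc hGd using fun k => TopologicalSpace.exists_countable_dense (Connective k)
  refine ⟨⋃ d, formulasOver PEmpty G d 0,
    Set.countable_iUnion fun d => countable_formulasOver hGc d 0, fun A B hAB σ => ?_⟩
  refine dist_le_zero.1 (le_of_forall_pos_le_add fun ε hε => ?_)
  obtain ⟨d, ψ, hψ, h⟩ := exists_formulasOver_near hGd σ (ε / 2) (half_pos hε)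
  have h1 : dist (Signature.Sentence.val A σ) (Signature.Sentence.val A ψ) ≤ ε / 2 := h A _ _
  have h2 : dist (Signature.Sentence.val B σ) (Signature.Sentence.val B ψ) ≤ ε / 2 := h B _ _
  rw [hAB ψ (Set.mem_iUnion.2 ⟨d, hψ⟩)] at h1
  rw [dist_comm] at h2
  linarith [dist_triangle (Signature.Sentence.val A σ) (Signature.Sentence.val B ψ)
    (Signature.Sentence.val B σ)]

/-! ### Isomorphisms -/

/-- `e` is an isomorphism of `L`-structures. -/
def IsIso {A B : L.Structure} (e : A ≃ B) : Prop :=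
  Isometry e ∧
    (∀ (n : ℕ) (f : L.Func n) (x : Fin n → A),
      e (Signature.Prestructure.func f x) = Signature.Prestructure.func f (e ∘ x)) ∧
    ∀ (n : ℕ) (P : L.Pred n) (x : Fin n → A),
      Signature.Prestructure.pred P (e ∘ x) = Signature.Prestructure.pred P x

lemma IsIso.symm {A B : L.Structure} {e : A ≃ B} (h : IsIso e) : IsIso e.symm := by
  refine ⟨fun x y => ?_, fun n f x => ?_, fun n P x => ?_⟩
  · rw [← h.1, e.apply_symm_apply, e.apply_symm_apply]
  · rw [e.symm_apply_eq, h.2.1, ← Function.comp_assoc, e.self_comp_symm, Function.id_comp]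
  · rw [← h.2.2, ← Function.comp_assoc, e.self_comp_symm, Function.id_comp]

lemma IsIso.trans {A B D : L.Structure} {e : A ≃ B} {e' : B ≃ D} (h : IsIso e) (h' : IsIso e') :
    IsIso (e.trans e') := by
  refine ⟨h'.1.comp h.1, fun n f x => ?_, fun n P x => ?_⟩
  · rw [Equiv.trans_apply, h.2.1, h'.2.1]
    rfl
  · rw [← h.2.2, ← h'.2.2]
    rfl

lemma IsIso.term_realize {A B : L.Structure} {e : A ≃ B} (h : IsIso e) {α : Type u} (v : α → A)
    (t : L.Term α) : t.realize (e ∘ v) = e (t.realize v) := by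
  induction t with
  | var a => rfl
  | func f ts ih =>
    simp only [Signature.Term.realize, ih, h.2.1]
    rfl

lemma IsIso.realize {A B : L.Structure} {e : A ≃ B} (h : IsIso e) {α : Type u} (v : α → A)
    {n : ℕ} (φ : L.Formula α n) (x : Fin n → A) :
    φ.realize (e ∘ v) (e ∘ x) = φ.realize v x := by
  induction φ with
  | dist s t =>
    simp only [Signature.Formula.realize, ← Sum.comp_elim, h.term_realize, h.1.dist_eq]
  | pred P ts =>
    simp only [Signature.Formula.realize, ← Sum.comp_elim, h.term_realize]
    exact h.2.2 _ _ _
  | conn g φs ih => simp only [Signature.Formula.realize, ih]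
  | sup φ ih =>
    simp only [Signature.Formula.realize, ← e.surjective.iSup_comp, ← Fin.comp_snoc, ih]
  | inf φ ih =>
    simp only [Signature.Formula.realize, ← e.surjective.iInf_comp, ← Fin.comp_snoc, ih]

lemma continuous_func {M : Type u} [PseudoMetricSpace M] [L.Prestructure M] {n : ℕ}
    (f : L.Func n) : Continuous (Signature.Prestructure.func f : (Fin n → M) → M) :=
  Metric.continuous_iff.2 fun _ ε hε => ⟨L.funcMod f (ε / 2), L.funcMod_pos f _ (half_pos hε),
    fun _ hy => (Signature.Prestructure.func_uc f _ (half_pos hε) _ _ hy).trans_lt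
      (half_lt_self hε)⟩

lemma continuous_pred {M : Type u} [PseudoMetricSpace M] [L.Prestructure M] {n : ℕ}
    (P : L.Pred n) : Continuous (Signature.Prestructure.pred P : (Fin n → M) → unitInterval) :=
  Metric.continuous_iff.2 fun _ ε hε => ⟨L.predMod P (ε / 2), L.predMod_pos P _ (half_pos hε),
    fun _ hy => (Signature.Prestructure.pred_uc P _ (half_pos hε) _ _ hy).trans_lt
      (half_lt_self hε)⟩

lemma _root_.Isometry.exists_continuous_extension {X A B : Type*} [PseudoMetricSpace X]
    [MetricSpace A] [MetricSpace B] [CompleteSpace B] {f : X → A} {g : X → B}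
    (hfi : Isometry f) (hf : DenseRange f) (hgi : Isometry g) :
    ∃ e : A → B, Continuous e ∧ ∀ x, e (f x) = g x := by
  have hd : IsDenseInducing f := ⟨hfi.isUniformInducing.isInducing, hf⟩
  exact ⟨hd.extend g, (uniformContinuous_uniformly_extend hfi.isUniformInducing hf
    hgi.uniformContinuous).continuous, fun x => hd.extend_eq hgi.continuous x⟩

/-- Two dense maps into complete metric spaces inducing the same distances differ by an
isometry. -/
lemma exists_isometry_of_dist_eq {X A B : Type*} [MetricSpace A] [CompleteSpace A]
    [MetricSpace B] [CompleteSpace B] {f : X → A} {g : X → B} (hf : DenseRange f)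
    (hg : DenseRange g) (h : ∀ x y, dist (f x) (f y) = dist (g x) (g y)) :
    ∃ e : A ≃ B, Isometry e ∧ ∀ x, e (f x) = g x := by
  let : PseudoMetricSpace X := PseudoMetricSpace.induced f inferInstance
  have hfi : Isometry f := Isometry.of_dist_eq fun x y => rfl
  have hgi : Isometry g := Isometry.of_dist_eq fun x y => (h x y).symm
  obtain ⟨e, he, hef⟩ := hfi.exists_continuous_extension hf hgi
  obtain ⟨e', he', heg⟩ := hgi.exists_continuous_extension hg hfi
  have h1 : e' ∘ e = id := hf.equalizer (he'.comp he) continuous_id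
    (by ext x; simp [hef, heg])
  have h2 : e ∘ e' = id := hg.equalizer (he.comp he') continuous_id
    (by ext x; simp [hef, heg])
  refine ⟨⟨e, e', congrFun h1, congrFun h2⟩, Isometry.of_dist_eq fun x y => ?_, hef⟩
  refine hf.induction_on₂ (p := fun x y => dist (e x) (e y) = dist x y)
    (isClosed_eq (by fun_prop) (by fun_prop)) (fun x y => ?_) x y
  rw [hef, hef, h]

/-- Structures in which the closed terms are dense and have the same atomic values are
isomorphic over the constants. -/
lemma exists_isIso_of_termVal {A B : L.CStructure C} (hA : DenseRange (termVal (L := L) A.const))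
    (hB : DenseRange (termVal (L := L) B.const))
    (hd : ∀ s t : L.CTerm C, dist (termVal A.const s) (termVal A.const t) =
      dist (termVal B.const s) (termVal B.const t))
    (hP : ∀ (n : ℕ) (P : L.Pred n) (ts : Fin n → L.CTerm C),
      Signature.Prestructure.pred P (termVal A.const ∘ ts) =
        Signature.Prestructure.pred P (termVal B.const ∘ ts)) :
    ∃ e : A.reduct ≃ B.reduct, IsIso e ∧ e ∘ A.const = B.const := by
  obtain ⟨e, he, hef⟩ := exists_isometry_of_dist_eq hA hB hd
  have hcomp : ∀ {n : ℕ} (ts : Fin n → L.CTerm C),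
      e ∘ (termVal A.const ∘ ts) = termVal B.const ∘ ts := fun ts => funext fun i => hef (ts i)
  have hAn : ∀ n, DenseRange fun ts : Fin n → L.CTerm C => termVal A.const ∘ ts := fun n =>
    DenseRange.piMap fun _ => hA
  have hcont : ∀ n, Continuous fun x : Fin n → A.reduct => e ∘ x := fun n =>
    continuous_pi fun i => he.continuous.comp (continuous_apply i)
  refine ⟨e, ⟨he, fun n f x => ?_, fun n P x => ?_⟩, funext fun c => hef (.var (.inl c))⟩
  · refine congrFun ((hAn n).equalizer (he.continuous.comp (continuous_func f))
      ((continuous_func f).comp (hcont n)) (funext fun ts => ?_)) x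
    simp only [Function.comp_apply]
    rw [hcomp]
    exact hef (.func f ts)
  · refine congrFun ((hAn n).equalizer ((continuous_pred P).comp (hcont n))
      (continuous_pred P) (funext fun ts => ?_)) x
    simp only [Function.comp_apply]
    rw [hcomp]
    exact (hP n P ts).symm

/-! ### Terms in the compiled structure -/

lemma completion_func_coe {X : Type u} [PseudoMetricSpace X] [L.Prestructure X] {n : ℕ}
    (f : L.Func n) (x : Fin n → X) :
    Signature.Prestructure.func f (piCoe X n x) =
      ((Signature.Prestructure.func f x : X) : Completion X) :=
  (piCoe_isDenseInducing n).extend_eq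
    ((Completion.continuous_coe X).comp (continuous_func f)) x

lemma completion_pred_coe {X : Type u} [PseudoMetricSpace X] [L.Prestructure X] {n : ℕ}
    (P : L.Pred n) (x : Fin n → X) :
    Signature.Prestructure.pred P (piCoe X n x) = Signature.Prestructure.pred P x :=
  (piCoe_isDenseInducing n).extend_eq (continuous_pred P) x

section compiled

variable [Nonempty C] {T : L.Theory} {p : Set (L.Expr C)}

lemma Definitive.termVal_compiled (h : Definitive T p) (t : L.CTerm C) :
    letI := h.pseudoMetric
    termVal h.compiled.const t = (t : Completion (L.CTerm C)) := by
  let := h.pseudoMetric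
  let := h.prestructure
  induction t with
  | var a =>
    rcases a with c | i
    · rfl
    · exact i.elim0
  | func f ts ih =>
    have : termVal h.compiled.const (.func f ts) =
        Signature.Prestructure.func f fun i => termVal h.compiled.const (ts i) := rfl
    rw [this, funext ih]
    exact completion_func_coe f ts

lemma Definitive.denseRange_termVal (h : Definitive T p) :
    DenseRange (termVal (L := L) h.compiled.const) := by
  let := h.pseudoMetric
  have : termVal (L := L) h.compiled.const = ((↑) : L.CTerm C → Completion (L.CTerm C)) :=
    funext h.termVal_compiled
  rw [this]
  exact Completion.denseRange_coe

lemma Definitive.dist_termVal (h : Definitive T p) {B : L.CStructure C} (hB : B.Satisfies T p)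
    (s t : L.CTerm C) : dist (termVal h.compiled.const s) (termVal h.compiled.const t) =
      dist (termVal B.const s) (termVal B.const t) := by
  let := h.pseudoMetric
  rw [h.termVal_compiled, h.termVal_compiled]
  exact (Completion.dist_eq s t).trans (h.dist_eq hB s t)

lemma Definitive.pred_termVal (h : Definitive T p) {B : L.CStructure C} (hB : B.Satisfies T p)
    {n : ℕ} (P : L.Pred n) (ts : Fin n → L.CTerm C) :
    Signature.Prestructure.pred P (termVal h.compiled.const ∘ ts) =
      Signature.Prestructure.pred P (termVal B.const ∘ ts) := by
  let := h.pseudoMetric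
  let := h.prestructure
  have : termVal h.compiled.const ∘ ts = piCoe (L.CTerm C) n ts :=
    funext fun i => h.termVal_compiled (ts i)
  rw [this]
  exact (completion_pred_coe P ts).trans (h.value_eq _ hB)

/-- The compiled structure is determined by any model of `T ∪ p` in which the closed terms
are dense. -/
lemma Definitive.exists_isIso (h : Definitive T p) {B : L.CStructure C} (hB : B.Satisfies T p)
    (hd : DenseRange (termVal (L := L) B.const)) :
    ∃ e : h.compiled.reduct ≃ B.reduct, IsIso e ∧ e ∘ h.compiled.const = B.const :=
  exists_isIso_of_termVal h.denseRange_termVal hd (h.dist_termVal hB) fun _ => h.pred_termVal hB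

end compiled

/-! ### Renaming constants in sets of expressions -/

/-- Renaming of constants in an expression. -/
def renameExpr (f : C → C) (e : L.Expr C) : L.Expr C := (Signature.Formula.mapConst f e.1, e.2)

lemma satisfies_rename {T : L.Theory} {M : L.Structure} {v : C → M} {f : C → C}
    {p : Set (L.Expr C)} :
    Signature.CStructure.Satisfies ⟨M, v⟩ T (renameExpr f '' p) ↔
      Signature.CStructure.Satisfies ⟨M, v ∘ f⟩ T p := by
  unfold Signature.CStructure.Satisfies
  rw [Set.forall_mem_image]
  simp only [renameExpr, Signature.CSentence.val, Signature.Formula.realize_mapConst]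

lemma renameExpr_symm_image (τ : C ≃ C) (p : Set (L.Expr C)) :
    renameExpr τ.symm '' (renameExpr τ '' p) = p := by
  rw [Set.image_image]
  simp [renameExpr, Signature.Formula.mapConst_mapConst, Signature.Formula.mapConst_id]

lemma renameExpr_image_symm (τ : C ≃ C) (p : Set (L.Expr C)) :
    renameExpr τ '' (renameExpr τ.symm '' p) = p :=
  renameExpr_symm_image τ.symm p

lemma Definitive.rename [Nonempty C] {T : L.Theory} {p : Set (L.Expr C)} (τ : C ≃ C)
    (h : Definitive T p) : Definitive T (renameExpr τ '' p) := by
  intro φ hφ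
  obtain ⟨A, hA⟩ := h.exists_model
  obtain ⟨r, hr, -⟩ := h (Signature.Formula.mapConst τ.symm φ) (hφ.mapConst _)
  have hval : ∀ {B : L.CStructure C}, B.Satisfies T (renameExpr τ '' p) →
      Signature.CSentence.val B φ = r := by
    intro B hB
    rw [← hr _ (satisfies_rename.1 hB)]
    simp only [Signature.CSentence.val, Signature.Formula.realize_mapConst, Function.comp_assoc,
      Equiv.self_comp_symm, Function.comp_id]
  have hsat : Signature.CStructure.Satisfies ⟨A.reduct, A.const ∘ τ.symm⟩ T (renameExpr τ '' p) :=
    satisfies_rename.2 (by simpa [Function.comp_assoc] using hA)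
  exact ⟨r, fun B hB => hval hB, fun r' hr' => (hr' _ hsat).symm.trans (hval hsat)⟩

lemma termVal_comp {M : Type u} [PseudoMetricSpace M] [L.Prestructure M] (v : C → M) (f : C → C)
    (t : L.CTerm C) : termVal (v ∘ f) t = termVal v (t.map (Sum.map f id)) := by
  rw [termVal, termVal, Signature.Term.realize_map, Sum.elim_comp_map, Function.comp_id]

/-- Renaming the constants by a permutation renames the constants of the compiled structure. -/
lemma Definitive.val_compiled_rename [Nonempty C] {T : L.Theory} {p : Set (L.Expr C)} (τ : C ≃ C)
    (h : Definitive T p) (h' : Definitive T (renameExpr τ '' p)) (φ : L.CSentence C) :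
    Signature.CSentence.val h'.compiled (Signature.Formula.mapConst τ φ) =
      Signature.CSentence.val h.compiled φ := by
  obtain ⟨A, hA⟩ := h'.exists_model
  have hA' := satisfies_rename.1 hA
  have hdense : DenseRange (termVal (L := L) (h'.compiled.const ∘ τ)) := by
    have : termVal (L := L) (h'.compiled.const ∘ τ) =
        termVal h'.compiled.const ∘ Signature.Term.map (Sum.map τ id) :=
      funext fun t => termVal_comp _ _ t
    rw [this]
    have hs : Function.Surjective (Signature.Term.map (L := L) (Sum.map τ (id : Fin 0 → Fin 0))) :=
      fun t => ⟨t.map (Sum.map τ.symm id), by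
        rw [Signature.Term.map_map, Sum.map_comp_map]
        simp [Signature.Term.map_id]⟩
    rw [DenseRange, hs.range_comp]
    exact h'.denseRange_termVal
  -- Atomic values on both sides are read off from the same structure `A`, with its constants
  -- permuted on one side.
  obtain ⟨e, he, hc⟩ := exists_isIso_of_termVal (A := h.compiled)
    (B := ⟨h'.compiled.reduct, h'.compiled.const ∘ τ⟩) h.denseRange_termVal hdense
    (fun s t => by
      rw [h.dist_termVal hA']
      simp only [termVal_comp]
      rw [h'.dist_termVal hA])
    (fun n P ts => by
      rw [h.pred_termVal hA']
      have : ∀ {M : Type u} [PseudoMetricSpace M] [L.Prestructure M] (v : C → M),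
          termVal (v ∘ τ) ∘ ts = termVal v ∘ fun i => (ts i).map (Sum.map τ id) :=
        fun v => funext fun i => termVal_comp v τ (ts i)
      simp only [this]
      rw [h'.pred_termVal hA])
  have := he.realize h.compiled.const φ Fin.elim0
  rw [hc, Subsingleton.elim (e ∘ Fin.elim0) Fin.elim0] at this
  simpa only [Signature.CSentence.val, Signature.Formula.realize_mapConst] using this

/-! ### Conditions are satisfied in `D` -/

/-- The supremum, over all assignments, of the degree of truth of `p` is a universal sentence. If it
vanished in `D` it would belong to the theory and vanish in every model, yet it is positive in the
model that witnesses the condition. -/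
lemma exists_assignment [Nonempty C] {D : L.Structure} (p : Condition (universalTheory D) C) :
    ∃ e : C → D, Signature.CStructure.Satisfies ⟨D, e⟩ (universalTheory D) p.1 := by
  obtain ⟨p, hfin, hres, A, hA⟩ := p
  obtain ⟨γ, hγqf, hγ⟩ := exists_degree_formula hfin
  obtain ⟨ψ, hψu, hψ⟩ := exists_sup_formula
    (γ.mapConst Sum.inl : L.Formula (C ⊕ PEmpty.{u + 1}) 0)
  have hψ' : ∀ M : L.Structure, Signature.Sentence.val M ψ =
      ⨆ e : C → M, γ.realize e Fin.elim0 := fun M => by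
    refine (hψ M _).trans ?_
    simp only [Signature.Formula.realize_mapConst, Sum.elim_comp_inl]
  by_contra hcon
  push Not at hcon
  have hD : Signature.Sentence.val D ψ = 0 := by
    rw [hψ']
    refine le_antisymm (iSup_le fun e => not_lt.1 fun hpos => hcon e ⟨fun σ hσ => hσ.2, ?_⟩) bot_le
    exact (hγ D e).2.1 hpos
  have hA0 := hA.1 ψ ⟨hψu ((hγqf fun e he => (hres e he).isQF).mapConst _), hD⟩
  rw [hψ'] at hA0
  have h1 := (hγ A.reduct A.const).2.2 hA.2
  have h2 := le_iSup (fun e : C → A.reduct => γ.realize e Fin.elim0) A.const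
  rw [hA0] at h2
  exact absurd h1 (not_lt.2 h2)

/-- The condition given by a finite set of restricted expressions true in `(D, e)`. -/
def mkCondition {D : L.Structure} (p : Set (L.Expr C)) (hfin : p.Finite)
    (hres : ∀ e ∈ p, Signature.Formula.IsRestrictedQF e.1) (e : C → D)
    (he : ∀ x ∈ p, (x.1.realize e Fin.elim0 : ℝ) < x.2) : Condition (universalTheory D) C :=
  ⟨p, hfin, hres, ⟨D, e⟩, fun _ hσ => hσ.2, he⟩

section games

variable {T : L.Theory}

/-! ### Plays and strategies -/

/-- `p` is a play in which `∃` follows the strategy `s`. -/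
def Strategy.IsPlay (s : Strategy T C) (p : ℕ → Condition T C) : Prop :=
  Monotone p ∧ ∀ j, Even j → p (j + 1) = s.move j fun i => p i

/-- `∃` can ensure that the set of expressions of a play has `Q`. -/
def EnsurableSet (T : L.Theory) (Q : Set (L.Expr C) → Prop) : Prop :=
  ∃ s : Strategy T C, ∀ p, s.IsPlay p → Q (playUnion p)

/-- `∃` can ensure `Q` in the plays in which `∀` starts with an extension of `q`. -/
def EnsurableBelow (q : Condition T C) (Q : Set (L.Expr C) → Prop) : Prop :=
  ∃ s : Strategy T C, ∀ p, s.IsPlay p → q ≤ p 0 → Q (playUnion p)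

/-- The set of expressions `S` is definitive and its compiled structure has `P`. -/
def CompilesTo [Nonempty C] (T : L.Theory) (P : L.CStructure C → Prop) (S : Set (L.Expr C)) :
    Prop :=
  ∃ h : Definitive T S, P h.compiled

lemma enforceable_iff_ensurableSet [Nonempty C] {P : L.CStructure C → Prop} :
    Enforceable T P ↔ EnsurableSet T (CompilesTo T P) := by
  simp only [Enforceable, EnsurableSet, Strategy.IsPlay, and_imp]
  rfl

/-- The play according to `s` in which `∀` starts with `q` and then passes. -/
def Strategy.play (s : Strategy T C) (q : Condition T C) : ℕ → Condition T C
  | 0 => q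
  | j + 1 => open Classical in
    if Even j then s.move j fun i : Fin (j + 1) => s.play q i else s.play q j
termination_by n => n
decreasing_by
  · exact i.2
  · exact Nat.lt_succ_self j

lemma Strategy.isPlay_play (s : Strategy T C) (q : Condition T C) : s.IsPlay (s.play q) := by
  have key : ∀ j, Even j → s.play q (j + 1) = s.move j fun i => s.play q i := fun j hj => by
    rw [Strategy.play, if_pos hj]
  refine ⟨monotone_nat_of_le_succ fun j => ?_, key⟩
  by_cases hj : Even j
  · rw [key j hj]
    exact s.legal j fun i => s.play q i
  · rw [Strategy.play, if_neg hj]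

lemma EnsurableSet.exists_play {Q : Set (L.Expr C) → Prop} (q : Condition T C)
    (h : EnsurableSet T Q) : ∃ S, Q S := by
  obtain ⟨s, hs⟩ := h
  exact ⟨_, hs _ (s.isPlay_play q)⟩

lemma EnsurableSet.mono {Q Q' : Set (L.Expr C) → Prop} (h : EnsurableSet T Q)
    (hQ : ∀ S, Q S → Q' S) : EnsurableSet T Q' := by
  obtain ⟨s, hs⟩ := h
  exact ⟨s, fun p hp => hQ _ (hs p hp)⟩

lemma EnsurableBelow.mono {q q' : Condition T C} {Q Q' : Set (L.Expr C) → Prop}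
    (h : EnsurableBelow q Q) (hq : q ≤ q') (hQ : ∀ S, q'.1 ⊆ S → Q S → Q' S) :
    EnsurableBelow q' Q' := by
  obtain ⟨s, hs⟩ := h
  exact ⟨s, fun p hp hp0 => hQ _ (Set.Subset.trans hp0 (Set.subset_iUnion (fun i => (p i).1) 0))
    (hs p hp (hq.trans hp0))⟩

/-- Forcing gives a separate strategy for each opening `p₀` above `q`. They glue to one strategy
since `p₀` can be read off from every later position. -/
lemma Forces.ensurableBelow [Nonempty C] {q : Condition T C} {P : L.CStructure C → Prop}
    (h : Forces q P) : EnsurableBelow q (CompilesTo T P) := by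
  classical
  have h0 : ∀ p₀ : Condition T C, q ≤ p₀ → WinningPosition T P 0 fun _ => p₀ := fun p₀ hp₀ =>
    h 0 _ monotone_const hp₀
  choose s hs using h0
  refine ⟨⟨fun k pos => if hp : q ≤ pos 0 then (s (pos 0) hp).move k pos else pos (Fin.last k),
    fun k pos => ?_⟩, fun p hp hq => ?_⟩
  · split_ifs with hp
    · exact (s _ hp).legal k pos
    · exact le_rfl
  · refine hs (p 0) hq p hp.1 (Fin.forall_fin_one.2 rfl) fun j _ hj => ?_
    exact (hp.2 j hj).trans (dif_pos hq)

lemma playUnion_comp {p : ℕ → Condition T C} (hp : Monotone p) {f : ℕ → ℕ}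
    (hf : ∀ i, ∃ j, i ≤ f j) : playUnion (fun i => p (f i)) = playUnion p := by
  refine Set.Subset.antisymm (Set.iUnion_subset fun i =>
    Set.subset_iUnion (fun i => (p i).1) (f i)) (Set.iUnion_subset fun i => ?_)
  obtain ⟨j, hj⟩ := hf i
  exact Set.Subset.trans (hp hj) (Set.subset_iUnion (fun i => (p (f i)).1) j)

/-- It suffices to be able to reach, from any condition, one below which `Q` can be ensured. -/
lemma ensurableSet_of_dense {Q : Set (L.Expr C) → Prop}
    (h : ∀ p : Condition T C, ∃ q, p ≤ q ∧ EnsurableBelow q Q) : EnsurableSet T Q := by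
  choose q hq s hs using h
  -- After the first reply `q (p 0)`, the first two moves are forgotten and the rest is treated as a
  -- new game opened by `p 2`. The answer for `k = 1` is never used.
  let σ : Strategy T C :=
    { move := fun k => match k with
        | 0 => fun pos => q (pos 0)
        | 1 => fun pos => pos 1
        | k + 2 => fun pos => (s (pos 0)).move k fun i => pos i.succ.succ
      legal := fun k => match k with
        | 0 => fun pos => hq (pos 0)
        | 1 => fun pos => le_rfl
        | k + 2 => fun pos => (s (pos 0)).legal k fun i => pos i.succ.succ }
  refine ⟨σ, fun p hp => ?_⟩
  rw [← playUnion_comp hp.1 (f := fun i => i + 2) fun i => ⟨i, Nat.le_add_right _ _⟩]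
  refine hs (p 0) _ ⟨fun i j hij => hp.1 (Nat.add_le_add_right hij 2), fun j hj => ?_⟩ ?_
  · exact hp.2 (j + 2) (hj.add even_two)
  · have h1 : p 1 = q (p 0) := hp.2 0 ⟨0, rfl⟩
    rw [← h1]
    exact hp.1 one_le_two

/-- The places of the `i`-th moves of the `n`-th of countably many interleaved games. -/
def interleave (n i : ℕ) : ℕ := 2 * Nat.pair n (i / 2) + i % 2

lemma interleave_two_mul (n k : ℕ) : interleave n (2 * k) = 2 * Nat.pair n k := by
  simp [interleave]

lemma interleave_two_mul_add_one (n k : ℕ) :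
    interleave n (2 * k + 1) = 2 * Nat.pair n k + 1 := by
  have h1 : (2 * k + 1) / 2 = k := by omega
  have h2 : (2 * k + 1) % 2 = 1 := by omega
  rw [interleave, h1, h2]

lemma interleave_monotone (n : ℕ) : Monotone (interleave n) := by
  refine monotone_nat_of_le_succ fun i => ?_
  obtain ⟨k, rfl | rfl⟩ := Nat.even_or_odd' i
  · rw [interleave_two_mul, interleave_two_mul_add_one]
    omega
  · rw [show 2 * k + 1 + 1 = 2 * (k + 1) by ring, interleave_two_mul, interleave_two_mul_add_one]
    have := Nat.pair_lt_pair_right n (Nat.lt_add_one k)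
    omega

/-- ∃ devotes her `m`-th move to game `n` as its `k`-th reply, where `m = Nat.pair n k`. All that
happened since her previous move in game `n` counts there as one move of ∀. Each subsequence is
cofinal, so all the games have the same union. -/
lemma ensurableSet_forall_nat {Q : ℕ → Set (L.Expr C) → Prop}
    (h : ∀ n, EnsurableSet T (Q n)) : EnsurableSet T fun S => ∀ n, Q n S := by
  classical
  choose s hs using h
  let F : ℕ → ℕ → (ℕ → Condition T C) → Condition T C := fun n k P =>
    (s n).move (2 * k) fun i => P (interleave n i)
  let G : ℕ → (ℕ → Condition T C) → Condition T C := fun m P =>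
    F (Nat.unpair m).1 (Nat.unpair m).2 P
  have hG : ∀ m P, P (2 * m) ≤ G m P := fun m P => by
    have := (s (Nat.unpair m).1).legal (2 * (Nat.unpair m).2)
      fun i => P (interleave (Nat.unpair m).1 i)
    simpa only [Fin.val_last, interleave_two_mul, Nat.pair_unpair] using this
  -- A finite position is extended to a sequence by repeating its last entry; the reply reads only
  -- actual entries.
  let pad : ∀ j, (Fin (j + 1) → Condition T C) → ℕ → Condition T C := fun j pos i =>
    pos ⟨min i j, Nat.lt_succ_of_le (min_le_right i j)⟩
  refine ⟨⟨fun j pos => if Even j then G (j / 2) (pad j pos) else pos (Fin.last j),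
    fun j pos => ?_⟩, fun p hp n => ?_⟩
  · split_ifs with hj
    · have h1 := hG (j / 2) (pad j pos)
      rw [Nat.two_mul_div_two_of_even hj] at h1
      have h2 : pad j pos j = pos (Fin.last j) := by
        simp only [pad, min_self]
        rfl
      rwa [h2] at h1
    · exact le_rfl
  · rw [← playUnion_comp hp.1 (f := interleave n) fun i => ⟨2 * i, by
      rw [interleave_two_mul]
      have := Nat.right_le_pair n i
      omega⟩]
    refine hs n _ ⟨hp.1.comp (interleave_monotone n), fun j hj => ?_⟩
    obtain ⟨k, rfl⟩ := even_iff_two_dvd.1 hj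
    simp only [interleave_two_mul_add_one]
    refine (hp.2 _ (even_two_mul _)).trans ((if_pos (even_two_mul _)).trans ?_)
    have hGF : ∀ P, G (2 * Nat.pair n k / 2) P = F n k P := fun P => by
      simp only [G, Nat.mul_div_cancel_left _ two_pos, Nat.unpair_pair]
    refine (hGF _).trans ?_
    simp only [F]
    congr 1
    ext1 i
    simp only [pad]
    congr 1
    refine min_eq_left ?_
    rw [← interleave_two_mul]
    exact interleave_monotone n (Nat.lt_succ_iff.1 i.2)

lemma ensurableSet_forall {ι : Sort*} [Countable ι] {Q : ι → Set (L.Expr C) → Prop}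
    (h : ∀ i, EnsurableSet T (Q i)) : EnsurableSet T fun S => ∀ i, Q i S := by
  cases isEmpty_or_nonempty ι
  · exact ⟨⟨fun k pos => pos (Fin.last k), fun _ _ => le_rfl⟩, fun _ _ i => isEmptyElim i⟩
  · obtain ⟨f, hf⟩ := exists_surjective_nat ι
    exact (ensurableSet_forall_nat fun n => h (f n)).mono fun S hS => hf.forall.2 hS

lemma EnsurableSet.and {Q Q' : Set (L.Expr C) → Prop} (h : EnsurableSet T Q)
    (h' : EnsurableSet T Q') : EnsurableSet T fun S => Q S ∧ Q' S :=
  (ensurableSet_forall (ι := Bool) (Q := fun b => bif b then Q else Q')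
    (Bool.forall_bool.2 ⟨h', h⟩)).mono fun _ hS => ⟨hS true, hS false⟩

/-! ### Renaming constants in conditions -/

/-- Renaming of the constants in a condition by a permutation. -/
def Condition.rename (τ : C ≃ C) (p : Condition T C) : Condition T C :=
  ⟨renameExpr τ '' p.1, p.2.1.image _, by
    rintro _ ⟨e, he, rfl⟩
    exact (p.2.2.1 e he).mapConst τ, by
    obtain ⟨A, hA⟩ := p.2.2.2
    exact ⟨⟨A.reduct, A.const ∘ τ.symm⟩,
      satisfies_rename.2 (by simpa [Function.comp_assoc] using hA)⟩⟩

lemma Condition.rename_mono (τ : C ≃ C) : Monotone (Condition.rename (T := T) τ) :=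
  fun _ _ h => Set.image_mono h

lemma Condition.rename_symm_rename (τ : C ≃ C) (p : Condition T C) :
    (p.rename τ).rename τ.symm = p :=
  Subtype.ext (renameExpr_symm_image τ p.1)

lemma Condition.rename_rename_symm (τ : C ≃ C) (p : Condition T C) :
    (p.rename τ.symm).rename τ = p :=
  Subtype.ext (renameExpr_image_symm τ p.1)

lemma EnsurableBelow.rename {q : Condition T C} {Q : Set (L.Expr C) → Prop}
    (h : EnsurableBelow q Q) (τ : C ≃ C) :
    EnsurableBelow (q.rename τ) fun S => Q (renameExpr τ.symm '' S) := by
  obtain ⟨s, hs⟩ := h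
  refine ⟨⟨fun k pos => (s.move k fun i => (pos i).rename τ.symm).rename τ, fun k pos => ?_⟩,
    fun p hp hq => ?_⟩
  · have := Condition.rename_mono τ (s.legal k fun i => (pos i).rename τ.symm)
    rwa [Condition.rename_rename_symm] at this
  · have hu : renameExpr τ.symm '' playUnion p = playUnion fun i => (p i).rename τ.symm :=
      Set.image_iUnion
    simp only [hu]
    refine hs _ ⟨(Condition.rename_mono τ.symm).comp hp.1, fun j hj => ?_⟩ ?_
    · simp only [hp.2 j hj]
      exact Condition.rename_symm_rename τ _
    · have := Condition.rename_mono τ.symm hq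
      rwa [Condition.rename_symm_rename] at this

/-- The game is invariant under permutations of the constants. This allows a forcing condition to be
moved to fresh constants. -/
lemma EnsurableBelow.rename_compilesTo [Nonempty C] {q : Condition T C} {φ : L.CSentence C} {r : ℝ}
    (h : EnsurableBelow q (CompilesTo T fun A => (Signature.CSentence.val A φ : ℝ) < r))
    (τ : C ≃ C) : EnsurableBelow (q.rename τ) (CompilesTo T fun A =>
      (Signature.CSentence.val A (Signature.Formula.mapConst τ φ) : ℝ) < r) := by
  refine (h.rename τ).mono le_rfl fun S _ ⟨hd, hS⟩ => ?_
  have key : CompilesTo T (fun A =>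
      (Signature.CSentence.val A (Signature.Formula.mapConst τ φ) : ℝ) < r)
      (renameExpr τ '' (renameExpr τ.symm '' S)) :=
    ⟨hd.rename τ, by simpa only [hd.val_compiled_rename τ (hd.rename τ) φ] using hS⟩
  rwa [renameExpr_image_symm] at key

end games

lemma exists_pos_le_le {b : unitInterval} (hb : 0 < b) {ε : ℝ} (hε : 0 < ε) :
    ∃ s : unitInterval, 0 < s ∧ s ≤ b ∧ (s : ℝ) ≤ ε := by
  have hb' : (0 : ℝ) < b := hb
  refine ⟨⟨min b ε, (lt_min hb' hε).le, (min_le_left _ _).trans b.2.2⟩, ?_, ?_, min_le_right _ _⟩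
  · exact lt_min hb' hε
  · exact min_le_left (b : ℝ) ε

/-! ### Merging assignments -/

/-- All expressions from `p` are true in `M` under the assignment `e`. -/
def Holds {M : Type u} [PseudoMetricSpace M] [L.Prestructure M] (e : C → M) (p : Set (L.Expr C)) :
    Prop :=
  ∀ x ∈ p, (x.1.realize e Fin.elim0 : ℝ) < x.2

lemma holds_rename {M : Type u} [PseudoMetricSpace M] [L.Prestructure M] {e : C → M} {f : C → C}
    {p : Set (L.Expr C)} : Holds e (renameExpr f '' p) ↔ Holds (e ∘ f) p := by
  unfold Holds
  rw [Set.forall_mem_image]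
  simp only [renameExpr, Signature.Formula.realize_mapConst]

lemma exists_support_of_finite {p : Set (L.Expr C)} (hp : p.Finite) : ∃ F : Set C, F.Finite ∧
    ∀ (M : Type u) [PseudoMetricSpace M] [L.Prestructure M] (v w : C → M),
      (∀ c ∈ F, v c = w c) → Holds v p → Holds w p := by
  choose F hF h using fun x : L.Expr C => sentence_exists_support x.1
  refine ⟨⋃ x ∈ p, F x, hp.biUnion fun x _ => hF x, fun M _ _ v w hvw hv x hx => ?_⟩
  rw [← h x M v w fun c hc => hvw c (Set.mem_biUnion hx hc)]
  exact hv x hx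

/-- A permutation of the constants which moves `F` away from `G`. -/
lemma exists_perm_disjoint [Countable C] [Infinite C] {F G : Set C} (hF : F.Finite)
    (hG : G.Finite) : ∃ τ : C ≃ C, ∀ c ∈ F, τ c ∉ G := by
  obtain ⟨κ⟩ := nonempty_equiv_of_countable (α := C) (β := ℕ)
  obtain ⟨N, hN⟩ := ((hF.union hG).image κ).bddAbove
  have hN' : ∀ c ∈ F ∪ G, κ c ≤ N := fun c hc => hN ⟨c, hc, rfl⟩
  -- The involution exchanges the blocks `[0, N]` and `[N + 1, 2N + 1]`; the first contains the
  -- codes of both `F` and `G`.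
  let f : ℕ → ℕ := fun n => if n ≤ N then n + (N + 1) else
    if n ≤ 2 * N + 1 then n - (N + 1) else n
  have hf : Function.Involutive f := fun n => by
    simp only [f]
    split_ifs <;> omega
  refine ⟨(κ.trans hf.toPerm).trans κ.symm, fun c hc hτ => ?_⟩
  have h1 := hN' _ (.inr hτ)
  have h2 := hN' c (.inl hc)
  simp only [Equiv.trans_apply, Equiv.apply_symm_apply, Function.Involutive.coe_toPerm, f,
    if_pos h2] at h1
  omega

/-- Assignments can be prescribed independently on `G` and, after renaming, on `F`. -/
lemma exists_perm_merge [Countable C] [Infinite C] {F G : Set C} (hF : F.Finite)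
    (hG : G.Finite) : ∃ τ : C ≃ C, ∀ (M : Type u) (e f : C → M),
      ∃ e' : C → M, (∀ c ∈ G, e' c = e c) ∧ ∀ c ∈ F, e' (τ c) = f c := by
  classical
  obtain ⟨τ, hτ⟩ := exists_perm_disjoint hF hG
  refine ⟨τ, fun M e f => ⟨fun c => if c ∈ G then e c else f (τ.symm c), fun c hc => if_pos hc,
    fun c hc => ?_⟩⟩
  simp [hτ c hc]

lemma exists_holds [Nonempty C] {D : L.Structure} (p : Condition (universalTheory D) C) :
    ∃ e : C → D, Holds e p.1 :=
  let ⟨e, he⟩ := exists_assignment p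
  ⟨e, he.2⟩

/-! ### Elementary embeddings and types -/

lemma IsElementaryEmbedding.realize {A B : L.Structure} {θ : A → B}
    (h : IsElementaryEmbedding A B θ) {K : Type u} [Finite K] (ψ : L.Formula K 0) (a : K → A) :
    ψ.realize (θ ∘ a) Fin.elim0 = ψ.realize a Fin.elim0 := by
  obtain ⟨n, ⟨κ⟩⟩ := Finite.exists_equiv_fin K
  let φ : L.LFormula n := ψ.subst fun k => .inr (κ k)
  have hφ : ∀ (M : L.Structure) (b : K → M), Signature.LFormula.val M φ (b ∘ κ.symm) =
      ψ.realize b Fin.elim0 := fun M b => by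
    have h1 := Signature.Formula.realize_subst (fun k => .inr (κ k))
      (fun x : PEmpty.{u + 1} => (x.elim : M)) (b ∘ κ.symm) ψ Fin.elim0
    have h2 : Sum.elim (fun x : PEmpty.{u + 1} => (x.elim : M)) (b ∘ κ.symm) ∘
        (fun k => .inr (κ k)) = b := funext fun k => by simp
    rw [h2] at h1
    rw [← h1, Signature.LFormula.val]
    congr 1
    ext i
    exact (Fin.append_left (b ∘ κ.symm) Fin.elim0 i).symm
  rw [← hφ, ← hφ]
  exact h n φ (a ∘ κ.symm)

/-- Every formula true at `a` is true at some tuple `ε`-close to `w`. -/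
def ApproximatesType {D : L.Structure} {K : Type u} (ε : ℝ) (w a : K → D) : Prop :=
  ∀ ψ : L.Formula K 0, 0 < ψ.realize a Fin.elim0 →
    ∃ y : K → D, (∀ i, dist (w i) (y i) < ε) ∧ 0 < ψ.realize y Fin.elim0

lemma ApproximatesType.trans_dist {D : L.Structure} {K : Type u} {ε η : ℝ} {w w' a : K → D}
    (h : ApproximatesType ε w a) (hw : ∀ i, dist (w' i) (w i) < η) :
    ApproximatesType (η + ε) w' a := fun ψ hψ =>
  let ⟨y, hy, hy'⟩ := h ψ hψ
  ⟨y, fun i => (dist_triangle _ (w i) _).trans_lt (add_lt_add (hw i) (hy i)), hy'⟩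

/-- That some assignment satisfies `γ` with the terms `η`-close to `y` is an open condition on `y`.
It holds at `a`, hence at some tuple `ε`-close to `w`. -/
lemma ApproximatesType.exists_near_left [Nonempty C] {D : L.Structure} {K : Type u}
    [Finite K] {ε η : ℝ} {w a : K → D}
    (h : ApproximatesType ε w a) {γ : L.CSentence C} {t : K → L.CTerm C} {g : C → D}
    (hg : 0 < γ.realize g Fin.elim0) (hga : ∀ i, dist (termVal g (t i)) (a i) < η) :
    ∃ g' : C → D, 0 < γ.realize g' Fin.elim0 ∧ ∀ i, dist (termVal g' (t i)) (w i) < η + ε := by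
  obtain ⟨ψ, hψ⟩ := exists_near_tuple_formula γ t η
  obtain ⟨y, hy, hψy⟩ := h ψ ((hψ D a).2.2 ⟨g, hg, hga⟩)
  obtain ⟨g', hg', hg'y⟩ := (hψ D y).2.1 hψy
  refine ⟨g', hg', fun i => (dist_triangle _ (y i) _).trans_lt (add_lt_add (hg'y i) ?_)⟩
  rw [dist_comm]
  exact hy i

/-- If the conclusion failed, the formula `ψ` measuring it would be `0` at `a`, hence less than `s`
at some `y` that is `ε`-close to the terms. But `g` itself gives `ψ` the value at least `s` at `y`:
the second `ε` in `2 * ε` pays for `s ≤ ε`. -/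
lemma ApproximatesType.exists_near_right [Nonempty C] {D : L.Structure} {K : Type u}
    [Finite K] {ε : ℝ} (hε : 0 < ε) {a : K → D}
    {γ : L.CSentence C} {t : K → L.CTerm C} {g : C → D}
    (h : ApproximatesType ε (fun i => termVal g (t i)) a) (hg : 0 < γ.realize g Fin.elim0) :
    ∃ g' : C → D, 0 < γ.realize g' Fin.elim0 ∧ ∀ i, dist (termVal g' (t i)) (a i) < 2 * ε := by
  obtain ⟨ψ, hψ⟩ := exists_near_tuple_formula γ t (2 * ε)
  refine (hψ D a).2.1 (pos_iff_ne_zero.2 fun h0 => ?_)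
  obtain ⟨s, hs, hsγ, hsε⟩ := exists_pos_le_le hg hε
  have hval : ∀ y : K → D, 0 < (Signature.Formula.conn (gapConn s) ![ψ]).realize y Fin.elim0 ↔
      ψ.realize y Fin.elim0 < s := fun y => gapConn_pos_iff
  obtain ⟨y, hy, hψy⟩ := h (.conn (gapConn s) ![ψ]) ((hval a).2 (by rwa [h0]))
  refine absurd ((hval y).1 hψy) (not_lt.2 ((hψ D y).1 s g hs hsγ fun i => ?_))
  linarith [hy i]

/-! ### Truth in `D` can be forced -/

section generic

variable [Countable C] [Infinite C] {D : L.Structure} {d : C → D}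

/-- If `φ < r` is compatible with the condition `p` in `D`, then some extension of `p`
forces it. -/
lemma exists_ensurableBelow (hgen : FiniteGenericPlus (universalTheory D) ⟨D, d⟩)
    (p : Condition (universalTheory D) C) {e : C → D} (he : Holds e p.1) {φ : L.CSentence C}
    {r : ℝ} (hφ : (φ.realize e Fin.elim0 : ℝ) < r) :
    ∃ p', p ≤ p' ∧ EnsurableBelow p' (CompilesTo (universalTheory D) fun A =>
      (Signature.CSentence.val A φ : ℝ) < r) := by
  obtain ⟨r₁, hr₁, hr₁r⟩ := exists_between hφ
  have hU : IsOpen {v : C → D | Holds v p.1 ∧ (φ.realize v Fin.elim0 : ℝ) < r₁} := by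
    refine IsOpen.inter ?_ (isOpen_lt (continuous_subtype_val.comp (continuous_realize φ))
      continuous_const)
    have : {v : C → D | Holds v p.1} =
        ⋂ x ∈ p.1, {v : C → D | (x.1.realize v Fin.elim0 : ℝ) < x.2} := by
      ext v
      simp [Holds]
    change IsOpen {v : C → D | Holds v p.1}
    rw [this]
    exact p.2.1.isOpen_biInter fun x _ => isOpen_lt
      (continuous_subtype_val.comp (continuous_realize x.1)) continuous_const
  have hdense : DenseRange fun σ : C → C => d ∘ σ := DenseRange.piMap fun _ => hgen.1
  -- By density of `d`, the assignment may be taken of the form `d ∘ σ`. Then `φ` renamed by `σ` is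
  -- a statement about the generic expansion itself, to which genericity applies.
  obtain ⟨σ, hσp, hσ⟩ := hdense.exists_mem_open hU ⟨e, he, hr₁⟩
  obtain ⟨q, hq, hforce⟩ := (hgen.2 (φ.mapConst σ) r₁
    ((unitInterval.nonneg _).trans_lt hr₁)).2 (by
      simpa only [Signature.CSentence.val, Signature.Formula.realize_mapConst] using hσ)
  obtain ⟨Fφ, hFφ, hmod⟩ := sentence_exists_modulus φ
  obtain ⟨δ, hδ, hmod⟩ := hmod (r - r₁) (sub_pos.2 hr₁r)
  obtain ⟨Fp, hFp, hsp⟩ := exists_support_of_finite p.2.1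
  obtain ⟨Fq, hFq, hsq⟩ := exists_support_of_finite q.2.1
  -- The condition `p` holds under `d ∘ σ` but `q` holds under `d`, and `σ` need not be injective.
  -- Moving `q` to other constants allows both to hold under one assignment `e'`.
  obtain ⟨τ, hτ⟩ := exists_perm_merge (hFq.union (hFφ.image σ)) (hFp.union hFφ)
  obtain ⟨e', he₁, he₂⟩ := hτ D (d ∘ σ) d
  -- These expressions tie each constant of `φ` to its renamed copy, so that the forced bound `r₁`
  -- on the copy of `φ` yields the bound `r` on `φ`.
  let N : Set (L.Expr C) :=
    (fun c => (.dist (.var (.inl c)) (.var (.inl (τ (σ c)))), δ)) '' Fφ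
  let p' : Condition (universalTheory D) C := mkCondition (p.1 ∪ (q.rename τ).1 ∪ N)
    ((p.2.1.union (q.rename τ).2.1).union (hFφ.image _)) (by
      rintro x ((hx | hx) | ⟨c, -, rfl⟩)
      · exact p.2.2.1 x hx
      · exact (q.rename τ).2.2.1 x hx
      · exact .atomic _ (.dist _ _)) e' (by
      rintro x ((hx | hx) | ⟨c, hc, rfl⟩)
      · exact hsp D _ _ (fun c hc => (he₁ c (.inl hc)).symm) hσp x hx
      · refine holds_rename.2 (hsq D d _ (fun c hc => (he₂ c (.inl hc)).symm) fun y hy => ?_) x hx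
        exact (hq hy).2
      · change dist (e' c) (e' (τ (σ c))) < δ
        rw [he₁ c (.inr hc), he₂ _ (.inr ⟨c, hc, rfl⟩)]
        simpa using hδ)
  refine ⟨p', fun x hx => .inl (.inl hx), (hforce.ensurableBelow.rename_compilesTo τ).mono
    (fun x hx => .inl (.inr hx)) fun S hS ⟨hd, hlt⟩ => ⟨hd, ?_⟩⟩
  obtain ⟨B, hB⟩ := hd.exists_model
  have hclose : ∀ c ∈ Fφ, dist (hd.compiled.const c) ((hd.compiled.const ∘ τ ∘ σ) c) < δ := by
    intro c hc
    have h1 := hd.dist_termVal hB (.var (.inl c)) (.var (.inl (τ (σ c))))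
    have h2 := hB.2 _ (hS (.inr ⟨c, hc, rfl⟩))
    exact h1.trans_lt h2
  have h1 := hmod hd.compiled.reduct _ _ hclose
  rw [Subtype.dist_eq, Real.dist_eq] at h1
  have h2 := (abs_lt.1 h1).2
  simp only [Signature.CSentence.val, Signature.Formula.realize_mapConst] at hlt ⊢
  rw [Function.comp_assoc] at hlt
  linarith

lemma ensurableSet_sentence_lt (hgen : FiniteGenericPlus (universalTheory D) ⟨D, d⟩)
    {σ : L.Sentence} {r : ℝ} (hσ : (Signature.Sentence.val D σ : ℝ) < r) :
    EnsurableSet (C := C) (universalTheory D) (CompilesTo (universalTheory D) fun A =>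
      (Signature.Sentence.val A.reduct σ : ℝ) < r) := by
  have hval : ∀ (M : L.Structure) (v : C → M), Signature.Formula.realize v
      (Signature.Formula.mapConst PEmpty.elim σ) Fin.elim0 = Signature.Sentence.val M σ :=
    fun M v => by
      rw [Signature.Formula.realize_mapConst, Signature.Sentence.val, Signature.LFormula.val]
      congr 1
      exact funext fun x => x.elim
  refine ensurableSet_of_dense fun p => ?_
  obtain ⟨e, he⟩ := exists_holds p
  obtain ⟨p', hp', h⟩ := exists_ensurableBelow hgen p he
    (φ := Signature.Formula.mapConst PEmpty.elim σ) (r := r) (by rwa [hval])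
  refine ⟨p', hp', h.mono le_rfl fun S _ ⟨hd, hS⟩ => ⟨hd, ?_⟩⟩
  simpa only [Signature.CSentence.val, hval] using hS

/-- Equality is the conjunction of countably many strict upper bounds for `σ` and for `1 - σ`. -/
lemma ensurableSet_sentence_eq (hgen : FiniteGenericPlus (universalTheory D) ⟨D, d⟩)
    (σ : L.Sentence) :
    EnsurableSet (C := C) (universalTheory D) (CompilesTo (universalTheory D) fun A =>
      Signature.Sentence.val A.reduct σ = Signature.Sentence.val D σ) := by
  have hneg : ∀ M : L.Structure, (Signature.Sentence.val M (.conn negConn ![σ]) : ℝ) =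
      1 - Signature.Sentence.val M σ := fun M => rfl
  have hpos : ∀ k : ℕ, (0 : ℝ) < 1 / (k + 1) := fun k => Nat.one_div_pos_of_nat
  refine (ensurableSet_forall_nat fun k : ℕ =>
    (ensurableSet_sentence_lt hgen (lt_add_of_pos_right (Signature.Sentence.val D σ : ℝ)
      (hpos k))).and (ensurableSet_sentence_lt hgen (lt_add_of_pos_right
        (Signature.Sentence.val D (.conn negConn ![σ]) : ℝ) (hpos k)))).mono fun S hS => ?_
  obtain ⟨⟨hd, -⟩, -⟩ := hS 0
  refine ⟨hd, Subtype.ext (le_antisymm ?_ ?_)⟩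
  · refine le_of_forall_pos_le_add fun ε hε => ?_
    obtain ⟨k, hk⟩ := exists_nat_one_div_lt hε
    obtain ⟨⟨_, h1⟩, -⟩ := hS k
    exact (h1.trans (by linarith)).le
  · refine le_of_forall_pos_le_add fun ε hε => ?_
    obtain ⟨k, hk⟩ := exists_nat_one_div_lt hε
    obtain ⟨-, ⟨_, h1⟩⟩ := hS k
    simp only [hneg] at h1
    linarith

/-! ### Types realized in a prime model are isolated -/

/-- In a finite-generic prime model, each finite tuple has a type that can be isolated by a
condition up to any precision. -/
lemma exists_isolating_condition [∀ n, Countable (L.Func n)] [∀ n, Countable (L.Pred n)]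
    (hgen : FiniteGenericPlus (universalTheory D) ⟨D, d⟩) (hprime : IsPrimeModel D)
    {K : Type u} [Finite K] [Nonempty K] (a : K → D) {ε : ℝ} (hε : 0 < ε) :
    ∃ (p : Condition (universalTheory D) C) (t : K → L.CTerm C), ∀ e : C → D, Holds e p.1 →
      ApproximatesType ε (fun i => termVal e (t i)) a := by
  by_contra hcon
  simp only [ApproximatesType] at hcon
  push Not at hcon
  -- The omission carries a positive threshold `s`, so that it follows from a strict inequality that
  -- can be forced. The bound `s ≤ ε / 2` leaves room for the final approximation by terms.
  let Omits : (K → L.CTerm C) → L.CStructure C → Prop := fun t A =>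
    ∃ (ψ : L.Formula K 0) (s : unitInterval), 0 < s ∧ s ≤ ψ.realize a Fin.elim0 ∧ (s : ℝ) ≤ ε / 2 ∧
      ∀ y : K → A.reduct, s ≤ ψ.realize y Fin.elim0 →
        ¬ ∀ i, dist (termVal A.const (t i)) (y i) + s ≤ ε
  have homit : ∀ t : K → L.CTerm C,
      EnsurableSet (universalTheory D) (CompilesTo (universalTheory D) (Omits t)) := by
    refine fun t => ensurableSet_of_dense fun p => ?_
    obtain ⟨e, he, ψ, hψ, hfar⟩ := hcon p t
    obtain ⟨γ, hγ⟩ := exists_near_terms_formula ψ t ε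
    obtain ⟨s, hs, hsψ, hsε⟩ := exists_pos_le_le hψ (half_pos hε)
    -- No tuple `ε`-close to `t` satisfies `ψ`, so `γ` vanishes at `e`; in particular `γ < s` is
    -- compatible with `p`.
    have h0 : γ.realize e Fin.elim0 = 0 := by
      by_contra hne
      obtain ⟨y, hy, hy'⟩ := (hγ D e).2 (pos_iff_ne_zero.2 hne)
      exact absurd hy (not_lt.2 (hfar y hy'))
    obtain ⟨p', hp', h⟩ := exists_ensurableBelow hgen p he (φ := γ) (r := s) (by rw [h0]; exact hs)
    refine ⟨p', hp', h.mono le_rfl fun S _ ⟨hd, hlt⟩ => ⟨hd, ψ, s, hs, hsψ, hsε,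
      fun y hy hclose => absurd hlt (not_lt.2 ?_)⟩⟩
    exact (hγ hd.compiled.reduct hd.compiled.const).1 s y hs hy hclose
  obtain ⟨S₀, hS₀, hequiv⟩ := exists_countable_elementarilyEquivalent (L := L)
  have := hS₀.to_subtype
  have hall := (ensurableSet_forall homit).and
    (ensurableSet_forall fun σ : S₀ => ensurableSet_sentence_eq (C := C) hgen σ.1)
  obtain ⟨S, hS, hS'⟩ := hall.exists_play (mkCondition ∅ Set.finite_empty (by simp) d (by simp))
  obtain ⟨hd, -⟩ := hS fun _ => .var (.inl (Classical.arbitrary C))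
  -- The image of `a` has the type of `a` and is within `ε / 2` of some tuple `t` of closed terms,
  -- which contradicts the omission at `t`.
  obtain ⟨θ, hθ⟩ := hprime hd.compiled.reduct (hequiv _ _ fun σ hσ =>
    let ⟨_, h⟩ := hS' ⟨σ, hσ⟩; h)
  choose t ht using fun i => hd.denseRange_termVal.exists_dist_lt (θ (a i)) (half_pos hε)
  obtain ⟨_, ψ, s, hs, hsa, hsε, hfar⟩ := hS t
  refine hfar (θ ∘ a) (by rwa [hθ.realize]) fun i => ?_
  have := ht i
  rw [dist_comm] at this
  simp only [Function.comp_apply]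
  linarith

/-- Each extension of `p` can be satisfied in `D` by moving the values of the constants from `F`
by less than `ε`. -/
def IsIsolating (ε : ℝ) (F : Set C) (p : Condition (universalTheory D) C) : Prop :=
  ∀ f : C → D, Holds f p.1 → ∀ p', p ≤ p' → ∃ g : C → D, Holds g p'.1 ∧
    ∀ c ∈ F, dist (f c) (g c) < ε

/-- A copy on fresh constants of a condition isolating the type of the `F`-tuple of `e` is added,
together with expressions tying its terms to `F`. Any two assignments satisfying the result give `F`
values approximating the same type, so one can be moved close to the other while the later condition
is satisfied. -/
lemma exists_isIsolating [∀ n, Countable (L.Func n)] [∀ n, Countable (L.Pred n)]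
    (hgen : FiniteGenericPlus (universalTheory D) ⟨D, d⟩) (hprime : IsPrimeModel D)
    (p : Condition (universalTheory D) C) {e : C → D} (he : Holds e p.1)
    {F : Set C} (hF : F.Finite) (hFne : F.Nonempty) {ε : ℝ} (hε : 0 < ε) :
    ∃ p', p ≤ p' ∧ IsIsolating ε F p' ∧ ∃ e' : C → D, Holds e' p'.1 ∧ ∀ c ∈ F, e' c = e c := by
  have := hF.to_subtype
  have := hFne.to_subtype
  let a : F → D := fun c => e c
  -- The `F`-tuples approximate the type up to `2η + η = 3η`; getting near `a` costs `6η`, and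
  -- getting back near `f` another `3η`.
  obtain ⟨η, hη, hηε⟩ : ∃ η > 0, 9 * η ≤ ε := ⟨ε / 9, by positivity, by linarith⟩
  obtain ⟨q, t, hqt⟩ := exists_isolating_condition (C := C) hgen hprime a hη
  obtain ⟨γ, -, hγ⟩ := exists_degree_formula q.2.1
  obtain ⟨e₀, he₀⟩ := exists_holds q
  obtain ⟨e₁, he₁, he₁a⟩ := (hqt e₀ he₀).exists_near_right hη ((hγ D e₀).2.2 he₀)
  replace he₁ : Holds e₁ q.1 := (hγ D e₁).2.1 he₁
  obtain ⟨Fp, hFp, hsp⟩ := exists_support_of_finite p.2.1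
  obtain ⟨Fq, hFq, hsq⟩ := exists_support_of_finite q.2.1
  choose Ft hFt hst using fun i => (t i).exists_support
  obtain ⟨τ, hτ⟩ := exists_perm_merge
    (hFq.union (Set.finite_iUnion fun i => (hFt i).preimage Sum.inl_injective.injOn))
    (hFp.union hF)
  obtain ⟨e', he'₁, he'₂⟩ := hτ D e e₁
  have het : ∀ i, termVal (e' ∘ τ) (t i) = termVal e₁ (t i) := fun i => by
    refine hst i D _ _ ?_
    rintro (c | j) hc
    · exact he'₂ c (.inr (Set.mem_iUnion.2 ⟨i, hc⟩))
    · exact j.elim0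
  let N : Set (L.Expr C) :=
    Set.range fun c : F => (.dist (.var (.inl c)) ((t c).map (Sum.map τ id)), 2 * η)
  have hp' : Holds e' (p.1 ∪ (q.rename τ).1 ∪ N) := by
    rintro x ((hx | hx) | ⟨c, rfl⟩)
    · exact hsp D _ _ (fun c hc => (he'₁ c (.inl hc)).symm) he x hx
    · exact holds_rename.2 (hsq D e₁ _ (fun c hc => (he'₂ c (.inl hc)).symm) he₁) x hx
    · change dist (e' c) (termVal e' ((t c).map (Sum.map τ id))) < 2 * η
      rw [← termVal_comp, het, he'₁ c (.inr c.2), dist_comm]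
      exact he₁a c
  let p' : Condition (universalTheory D) C := mkCondition (p.1 ∪ (q.rename τ).1 ∪ N)
    ((p.2.1.union (q.rename τ).2.1).union (Set.finite_range _)) (by
      rintro x ((hx | hx) | ⟨c, rfl⟩)
      · exact p.2.2.1 x hx
      · exact (q.rename τ).2.2.1 x hx
      · exact .atomic _ (.dist _ _)) e' hp'
  have key : ∀ f : C → D, Holds f p'.1 →
      ApproximatesType (3 * η) (fun c : F => termVal (L := L) f (.var (.inl c))) a := by
    intro f hf
    have h1 : Holds (f ∘ τ) q.1 := holds_rename.1 fun x hx => hf x (.inl (.inr hx))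
    have h2 := (hqt _ h1).trans_dist (w' := fun c : F => termVal (L := L) f (.var (.inl c)))
      (η := 2 * η) fun c => by
        rw [termVal_comp]
        exact hf _ (.inr ⟨c, rfl⟩)
    rwa [show 2 * η + η = 3 * η by ring] at h2
  refine ⟨p', fun x hx => .inl (.inl hx), fun f hf p'' hp'' => ?_, e', hp',
    fun c hc => he'₁ c (.inr hc)⟩
  obtain ⟨γ', -, hγ'⟩ := exists_degree_formula p''.2.1
  obtain ⟨h, hh⟩ := exists_holds p''
  -- The detour through `a`: the larger condition is first satisfied with `F` near `a`, then with
  -- `F` near `f`.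
  obtain ⟨g, hg, hga⟩ := (key h fun x hx => hh x (hp'' hx)).exists_near_right (by positivity)
    ((hγ' D h).2.2 hh)
  obtain ⟨g', hg', hg'f⟩ := (key f hf).exists_near_left hg hga
  refine ⟨g', (hγ' D g').2.1 hg', fun c hc => ?_⟩
  have := hg'f ⟨c, hc⟩
  rw [dist_comm] at this
  exact this.trans_le (by linarith)

end generic

/-! ### A strategy that builds a copy of `D` -/

section build

variable {D : L.Structure}

/-- The memory of `∃`: an assignment of the constants in `D` and the set of the constants whose
values are under control. -/
abbrev BuildState (C : Type u) (D : L.Structure) : Type u := (C → D) × Set C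

/-- A good reply `z.1` of `∃` to the condition `p`, with memory `st`, at stage `m`, and her new
memory `z.2`. The constant `c` gets under control, and some constant is interpreted by `b`. -/
structure IsGoodReply (m : ℕ) (c : C) (b : D) (st : BuildState C D)
    (p : Condition (universalTheory D) C) (z : Condition (universalTheory D) C × BuildState C D) :
    Prop where
  le : p ≤ z.1
  holds : Holds z.2.1 z.1.1
  subset : st.2 ⊆ z.2.2
  finite : z.2.2.Finite
  mem : c ∈ z.2.2
  close : ∀ c ∈ st.2, dist (st.1 c) (z.2.1 c) < (1 / 2) ^ m
  hits : ∃ c ∈ z.2.2, z.2.1 c = b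
  isolating : IsIsolating ((1 / 2) ^ (m + 1)) z.2.2 z.1
  shrinks : ∀ x ∈ p.1, ∃ r < x.2, (x.1, r) ∈ z.1.1

/-- A constant `c'` occurring neither in `p` nor among the controlled ones can be given the value
`b` freely. Isolation for the enlarged controlled set then prepares the next stage. -/
lemma exists_isGoodReply [Countable C] [Infinite C] [∀ n, Countable (L.Func n)]
    [∀ n, Countable (L.Pred n)] {d : C → D}
    (hgen : FiniteGenericPlus (universalTheory D) ⟨D, d⟩) (hprime : IsPrimeModel D)
    (m : ℕ) (c : C) (b : D) {st : BuildState C D} (hst : st.2.Finite)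
    {p : Condition (universalTheory D) C} {g : C → D} (hg : Holds g p.1)
    (hgst : ∀ c ∈ st.2, dist (st.1 c) (g c) < (1 / 2) ^ m) : ∃ z, IsGoodReply m c b st p z := by
  classical
  obtain ⟨Fp, hFp, hsp⟩ := exists_support_of_finite p.2.1
  obtain ⟨c', hc'⟩ := (hFp.union (hst.insert c)).exists_notMem
  have hc'p : ∀ x ∈ Fp, x ≠ c' := fun x hx h => hc' (h ▸ .inl hx)
  have hc'F : ∀ x ∈ st.2, x ≠ c' := fun x hx h => hc' (h ▸ .inr (.inr hx))
  have hg' : Holds (Function.update g c' b) p.1 := hsp D g _ (fun x hx =>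
    (Function.update_of_ne (hc'p x hx) _ _).symm) hg
  obtain ⟨q, hpq, hq, e, he, heF⟩ := exists_isIsolating hgen hprime p hg'
    (F := insert c' (insert c st.2)) ((hst.insert c).insert c') (Set.insert_nonempty _ _)
    (ε := (1 / 2) ^ (m + 1)) (by positivity)
  -- Each bound of `p` is lowered to the midpoint between the present value and the old bound, so
  -- that the strict inequality survives in the limit.
  let N : Set (L.Expr C) := (fun x => (x.1, ((x.1.realize e Fin.elim0 : ℝ) + x.2) / 2)) '' p.1
  have heN : Holds e (q.1 ∪ N) := by
    rintro x (hx | ⟨y, hy, rfl⟩)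
    · exact he x hx
    · have := he y (hpq hy)
      simp only
      linarith
  let q' : Condition (universalTheory D) C := mkCondition (q.1 ∪ N)
    (q.2.1.union (p.2.1.image _)) (by
      rintro x (hx | ⟨y, hy, rfl⟩)
      · exact q.2.2.1 x hx
      · exact p.2.2.1 y hy) e heN
  refine ⟨(q', e, insert c' (insert c st.2)), fun x hx => .inl (hpq hx), heN,
    fun x hx => .inr (.inr hx), (hst.insert c).insert c', .inr (.inl rfl), fun x hx => ?_,
    ⟨c', .inl rfl, ?_⟩, fun f hf p' hp' => ?_, fun x hx => ?_⟩
  · simp only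
    rw [heF x (.inr (.inr hx)), Function.update_of_ne (hc'F x hx)]
    exact hgst x hx
  · simp only
    rw [heF c' (.inl rfl), Function.update_self]
  · exact hq f (fun x hx => hf x (.inl hx)) p' (Set.subset_union_left.trans hp')
  · refine ⟨_, ?_, .inr ⟨x, hx, rfl⟩⟩
    have := he x (hpq hx)
    linarith

open Classical in
/-- The reply of `∃` with memory `st` to the condition `p` at stage `m`, and her new memory. -/
def reply (κ : ℕ → C) (b : ℕ → D) (m : ℕ) (st : BuildState C D)
    (p : Condition (universalTheory D) C) : Condition (universalTheory D) C × BuildState C D :=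
  if h : ∃ z, IsGoodReply m (κ m) (b m) st p z then h.choose else (p, st)

lemma isGoodReply_reply {κ : ℕ → C} {b : ℕ → D} {m : ℕ} {st : BuildState C D}
    {p : Condition (universalTheory D) C} (h : ∃ z, IsGoodReply m (κ m) (b m) st p z) :
    IsGoodReply m (κ m) (b m) st p (reply κ b m st p) := by
  rw [reply, dif_pos h]
  exact h.choose_spec

lemma le_reply (κ : ℕ → C) (b : ℕ → D) (m : ℕ) (st : BuildState C D)
    (p : Condition (universalTheory D) C) : p ≤ (reply κ b m st p).1 := by
  by_cases h : ∃ z, IsGoodReply m (κ m) (b m) st p z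
  · exact (isGoodReply_reply h).le
  · rw [reply, dif_neg h]

/-- The memory of `∃` before her `m`-th move. -/
def memory (κ : ℕ → C) (b : ℕ → D) (p : ℕ → Condition (universalTheory D) C) :
    ℕ → BuildState C D
  | 0 => (fun _ => b 0, ∅)
  | m + 1 => (reply κ b m (memory κ b p m) (p (2 * m))).2

lemma memory_congr (κ : ℕ → C) (b : ℕ → D) {p p' : ℕ → Condition (universalTheory D) C} :
    ∀ {m : ℕ}, (∀ i < 2 * m, p i = p' i) → memory κ b p m = memory κ b p' m
  | 0, _ => rfl
  | m + 1, h => by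
    rw [memory, memory, memory_congr κ b fun i hi => h i (by omega), h (2 * m) (by omega)]

open Classical in
/-- The strategy that builds a copy of `D`. -/
def buildStrategy (κ : ℕ → C) (b : ℕ → D) : Strategy (universalTheory D) C where
  move j pos := if Even j then
      (reply κ b (j / 2) (memory κ b
        (fun i => pos ⟨min i j, Nat.lt_succ_of_le (min_le_right i j)⟩) (j / 2))
        (pos (Fin.last j))).1
    else pos (Fin.last j)
  legal j pos := by
    split_ifs
    · exact le_reply _ _ _ _ _
    · exact le_rfl

lemma buildStrategy_isPlay {κ : ℕ → C} {b : ℕ → D} {p : ℕ → Condition (universalTheory D) C}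
    (hp : (buildStrategy κ b).IsPlay p) (m : ℕ) :
    p (2 * m + 1) = (reply κ b m (memory κ b p m) (p (2 * m))).1 := by
  rw [hp.2 _ (even_two_mul m)]
  simp only [buildStrategy, if_pos (even_two_mul m), Nat.mul_div_cancel_left m two_pos,
    Fin.val_last]
  rw [memory_congr κ b fun i hi => by rw [min_eq_left hi.le]]

/-- The isolation secured at stage `m` provides, for any answer of ∀, the nearby assignment required
at stage `m + 1`. At stage `0` nothing is controlled, so any satisfying assignment serves. -/
lemma isGoodReply_of_isPlay [Countable C] [Infinite C] [∀ n, Countable (L.Func n)]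
    [∀ n, Countable (L.Pred n)] {d : C → D}
    (hgen : FiniteGenericPlus (universalTheory D) ⟨D, d⟩) (hprime : IsPrimeModel D)
    {κ : ℕ → C} {b : ℕ → D} {p : ℕ → Condition (universalTheory D) C}
    (hp : (buildStrategy κ b).IsPlay p) :
    ∀ m, IsGoodReply m (κ m) (b m) (memory κ b p m) (p (2 * m))
      (p (2 * m + 1), memory κ b p (m + 1)) := by
  have key : ∀ m, (memory κ b p m).2.Finite → (∃ g : C → D, Holds g (p (2 * m)).1 ∧
      ∀ c ∈ (memory κ b p m).2, dist ((memory κ b p m).1 c) (g c) < (1 / 2) ^ m) →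
      IsGoodReply m (κ m) (b m) (memory κ b p m) (p (2 * m))
        (p (2 * m + 1), memory κ b p (m + 1)) := by
    rintro m hfin ⟨g, hg, hclose⟩
    have := isGoodReply_reply (exists_isGoodReply hgen hprime m (κ m) (b m) hfin hg hclose)
    rw [buildStrategy_isPlay hp, memory]
    exact this
  intro m
  induction m with
  | zero =>
    obtain ⟨g, hg⟩ := exists_holds (p 0)
    exact key 0 Set.finite_empty ⟨g, hg, fun c hc => hc.elim⟩
  | succ m ih =>
    exact key (m + 1) ih.finite (ih.isolating _ ih.holds _ (hp.1 (by omega)))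

/-- `∃` can ensure that `⋃ p_i` holds in `D` for a dense interpretation of the constants. -/
lemma ensurableSet_exists_denseRange [Countable C] [Infinite C] [∀ n, Countable (L.Func n)]
    [∀ n, Countable (L.Pred n)] {d : C → D}
    (hgen : FiniteGenericPlus (universalTheory D) ⟨D, d⟩) (hprime : IsPrimeModel D) :
    EnsurableSet (universalTheory D) fun S : Set (L.Expr C) =>
      ∃ e : C → D, DenseRange e ∧ Holds e S := by
  obtain ⟨κ, hκ⟩ := exists_surjective_nat C
  -- Each `d (κ n)` is the target at every stage `Nat.pair n k`, hence at arbitrarily late stages,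
  -- where the constant hitting it drifts very little afterwards.
  let b : ℕ → D := fun m => d (κ (Nat.unpair m).1)
  refine ⟨buildStrategy κ b, fun p hp => ?_⟩
  have hgood := isGoodReply_of_isPlay hgen hprime hp
  let e : ℕ → C → D := fun m => (memory κ b p m).1
  let F : ℕ → Set C := fun m => (memory κ b p m).2
  have hF : Monotone F := monotone_nat_of_le_succ fun m => (hgood m).subset
  have hlim : ∀ k, ∀ c ∈ F k, ∃ l, Tendsto (fun m => e m c) atTop (𝓝 l) ∧
      dist (e k c) l ≤ 2 * (1 / 2) ^ k := by
    intro k c hc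
    have hstep : ∀ i, dist (e (i + k) c) (e (i + 1 + k) c) ≤ 2 * (1 / 2) ^ k / 2 / 2 ^ i := by
      intro i
      have := (hgood (i + k)).close c (hF (Nat.le_add_left k i) hc)
      rw [show i + 1 + k = i + k + 1 by ring]
      refine this.le.trans (le_of_eq ?_)
      rw [pow_add, one_div_pow, one_div_pow]
      field_simp
    obtain ⟨l, hl⟩ := cauchySeq_tendsto_of_complete (cauchySeq_of_le_geometric_two hstep)
    refine ⟨l, (tendsto_add_atTop_iff_nat (f := fun m => e m c) k).1 hl, ?_⟩
    simpa using dist_le_of_le_geometric_two_of_tendsto₀ hstep hl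
  have hmem : ∀ c, ∃ k, c ∈ F k := fun c => by
    obtain ⟨m, rfl⟩ := hκ c
    exact ⟨m + 1, (hgood m).mem⟩
  have hex : ∀ c, ∃ l, Tendsto (fun m => e m c) atTop (𝓝 l) := fun c =>
    let ⟨k, hk⟩ := hmem c
    let ⟨l, hl, _⟩ := hlim k c hk
    ⟨l, hl⟩
  choose e' he' using hex
  have hdist : ∀ k, ∀ c ∈ F k, dist (e k c) (e' c) ≤ 2 * (1 / 2) ^ k := by
    intro k c hc
    obtain ⟨l, hl, hle⟩ := hlim k c hc
    rwa [tendsto_nhds_unique (he' c) hl]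
  refine ⟨e', Metric.denseRange_iff.2 fun x ε hε => ?_, fun x hx => ?_⟩
  · obtain ⟨c, hc⟩ := hgen.1.exists_dist_lt x (half_pos hε)
    obtain ⟨n, rfl⟩ := hκ c
    obtain ⟨k, hk⟩ := exists_pow_lt_of_lt_one (half_pos hε) (one_half_lt_one (α := ℝ))
    obtain ⟨c', hc'F, hc'⟩ := (hgood (Nat.pair n k)).hits
    have h1 := hdist _ c' hc'F
    have h2 : e (Nat.pair n k + 1) c' = d (κ n) := by
      simpa only [b, Nat.unpair_pair] using hc'
    have h3 : (1 / 2 : ℝ) ^ Nat.pair n k ≤ (1 / 2) ^ k :=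
      pow_le_pow_of_le_one (by norm_num) (by norm_num) (Nat.right_le_pair n k)
    rw [h2, pow_succ] at h1
    refine ⟨c', (dist_triangle x (d (κ n)) _).trans_lt ?_⟩
    simp only at hc
    linarith
  · obtain ⟨i, hi⟩ := Set.mem_iUnion.1 hx
    -- Along the later assignments the value stays below some `r` smaller than the original bound.
    -- By continuity its limit is at most `r`.
    obtain ⟨r, hr, hxr⟩ := (hgood i).shrinks x (hp.1 (by omega : i ≤ 2 * i) hi)
    refine lt_of_le_of_lt ?_ hr
    have ht : Tendsto (fun m => (x.1.realize (e m) Fin.elim0 : ℝ)) atTop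
        (𝓝 (x.1.realize e' Fin.elim0 : ℝ)) :=
      ((continuous_subtype_val.comp (continuous_realize x.1)).tendsto e').comp
        (tendsto_pi_nhds.2 he')
    refine le_of_tendsto ht ?_
    filter_upwards [eventually_gt_atTop i] with m hm
    obtain ⟨m, rfl⟩ : ∃ k, m = k + 1 := ⟨m - 1, by omega⟩
    exact ((hgood m).holds _ (hp.1 (by omega : 2 * i + 1 ≤ 2 * m + 1) hxr)).le

end build

/-! ### Enforceability of `D` and uniqueness -/

lemma enforceableStructure_of_isPrimeModel [Countable C] [Infinite C] [∀ n, Countable (L.Func n)]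
    [∀ n, Countable (L.Pred n)] {D : L.Structure} {d : C → D}
    (hgen : FiniteGenericPlus (universalTheory D) ⟨D, d⟩) (hprime : IsPrimeModel D) :
    EnforceableStructure C (universalTheory D) D := by
  -- The constant sentence `0` is a dummy: it contributes only that the play is definitive.
  refine enforceable_iff_ensurableSet.2 (((ensurableSet_exists_denseRange hgen hprime).and
    (ensurableSet_sentence_eq hgen (.conn (k := 0) (ContinuousMap.const _ 0) Fin.elim0))).mono
      fun S => ?_)
  rintro ⟨⟨e, hdense, he⟩, hd, -⟩
  obtain ⟨θ, hθ, -⟩ := hd.exists_isIso (B := ⟨D, e⟩) ⟨fun σ hσ => hσ.2, he⟩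
    (Dense.mono (by rintro _ ⟨c, rfl⟩; exact ⟨.var (.inl c), rfl⟩) hdense)
  exact ⟨hd, θ, hθ⟩

end ContLogic

end

theorem mainTheorem9 (L : ContLogic.Signature.{u})
    [∀ n, Countable (L.Func n)] [∀ n, Countable (L.Pred n)]
    (C : Type u) [Countable C] [Infinite C] (D : L.Structure)
    (hgen : ContLogic.FiniteGeneric C (ContLogic.universalTheory D) D)
    (hprime : ContLogic.IsPrimeModel D) :
    ContLogic.IsTheEnforceableModel C (ContLogic.universalTheory D) D := by
  obtain ⟨d, hd⟩ := hgen
  have hD := ContLogic.enforceableStructure_of_isPrimeModel hd hprime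
  refine ⟨fun σ hσ => hσ.2, hD, fun E hE => ?_⟩
  -- One play, opened with the empty condition, is won for both properties, so a single compiled
  -- structure is isomorphic to `E` and to `D`.
  obtain ⟨S, ⟨_, e, he⟩, ⟨_, e', he'⟩⟩ := ((ContLogic.enforceable_iff_ensurableSet.1 hE).and
    (ContLogic.enforceable_iff_ensurableSet.1 hD)).exists_play
      (ContLogic.mkCondition ∅ Set.finite_empty (by simp) d (by simp))
  exact ⟨_, (ContLogic.IsIso.symm he).trans he'⟩
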